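/- A composition of size $n\ge 1$ is a list $\alpha=(a_1,\dots,a_k)$ of $k\ge1$ positive integers with sum $n$; put $|\alpha|=n$, $l(\alpha)=k$ and $\alpha^*=(a_k,\dots,a_1)$. It is symmetric if $\alpha=\alpha^*$, asymmetric otherwise, and lexicographic minimal if $\alpha\le\alpha^*$ in the lexicographic order. For compositions $\alpha=(a_1,\dots,a_k)$ and $\beta=(b_1,\dots,b_m)$ write $\alpha\cdot\beta$ for concatenation, $\alpha\odot\beta=(a_1,\dots,a_{k-1},a_k+b_1,b_2,\dots,b_m)$, $\beta^{\odot a}=\beta\odot\cdots\odot\beta$ ($a$ copies), and $\alpha\circ\beta=\beta^{\odot a_1}\cdot\beta^{\odot a_2}\cdots\beta^{\odot a_k}$. A factorisation $\beta\circ\gamma$ is trivial if $\beta=(1)$ or $\gamma=(1)$, or $\beta$ and $\gamma$ both have length $1$, or both have all components equal to $1$. An irreducible factorisation of $\alpha$ is an expression $\alpha=\alpha_1\circ\cdots\circ\alpha_k$ with $k\ge1$ in which no $\alpha_i\circ\alpha_{i+1}$ is trivial and each $\alpha_i$ admits only trivial factorisations; every composition has exactly one. A composition is normalised if all factors of its irreducible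 factorisation are lexicographic minimal. Let $C_n(x)$, $S_n(x)$, $L^\times_n(x)$, $R_n(x)$ be the polynomials $\sum_\alpha x^{l(\alpha)}$, where $\alpha$ runs over the compositions of size $n$ that are, respectively, arbitrary, symmetric, asymmetric and lexicographic minimal, normalised. Let $R^1_n(x)$ be the same sum over the normalised compositions of size $n$ whose first factor in the irreducible factorisation is asymmetric and whose remaining factors (if any) are symmetric. **Theorem.** For every $n\ge1$, $$R^1_n(x)=\sum_{\substack{k\ge0\\ 1=d_0\mid d_1\mid\cdots\mid d_k\mid n\\ d_i\ne d_{i+1}\ (0\le i\le k-1)}}(-1)^k\,L^\times_{n/d_k}(x^{d_k})\prod_{i=0}^{k-1}\frac{C_{d_{i+1}/d_i}(x^{d_i})}{x^{d_{i+1}}}$$ and $$R_n(x)=\sum_{\substack{k\ge0\\ d_1\mid d_2\mid\cdots\mid d_{k+1}=n\\ d_i\ne d_{i+1}\ (1\le i\le k)}}S_{d_1}(x)\prod_{i=1}^{k}\frac{R^1_{d_{i+1}/d_i}(x^{d_i})}{x^{d_i}}.$$ -/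

import Mathlib

namespace RibbonComp

/-- A composition (of some positive integer): a nonempty list of positive integers.
Its size is `α.sum`, its length is `α.length`, its reversal is `α.reverse`. -/
def IsComp (α : List ℕ) : Prop := α ≠ [] ∧ ∀ a ∈ α, 0 < a

/-- Near concatenation `(a₁, …, aₖ + b₁, …, bₗ)`; the empty list is a neutral element. -/
def nearConcat : List ℕ → List ℕ → List ℕ
  | [], β => β
  | [a], [] => [a]
  | [a], b :: β => (a + b) :: β
  | a :: a' :: α, β => a :: nearConcat (a' :: α) β

/-- The `n`-fold near concatenation of `α` with itself. -/
def nearPow (α : List ℕ) : ℕ → List ℕ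
  | 0 => []
  | n + 1 => nearConcat α (nearPow α n)

/-- The composition `α ∘ β`: the concatenation of the `aᵢ`-fold near concatenations of `β`. -/
def circ (α β : List ℕ) : List ℕ := α.flatMap (nearPow β)

/-- `α` coincides with its reversal. -/
def IsSymm (α : List ℕ) : Prop := α.reverse = α

/-- `α ≤ α*` in the lexicographic order (the order of `List ℕ`). -/
def IsLexMin (α : List ℕ) : Prop := α ≤ α.reverse

/-- The factorisation `β ∘ γ` is trivial. -/
def IsTrivialPair (β γ : List ℕ) : Prop :=
  (β = [1] ∨ γ = [1]) ∨
  (β.length = 1 ∧ γ.length = 1) ∨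
  ((∀ b ∈ β, b = 1) ∧ (∀ c ∈ γ, c = 1))

/-- `α` admits only trivial factorisations. -/
def OnlyTrivial (α : List ℕ) : Prop :=
  ∀ β γ : List ℕ, IsComp β → IsComp γ → circ β γ = α → IsTrivialPair β γ

/-- `α = α₁ ∘ ⋯ ∘ αₖ` (with `k ≥ 1`) is an irreducible factorisation of `α`, where
`l = [α₁, …, αₖ]`: no two neighbouring factors form a trivial factorisation and every factor
admits only trivial factorisations. -/
def IsIrredFactorisation (l : List (List ℕ)) (α : List ℕ) : Prop :=
  l ≠ [] ∧
  (∀ β ∈ l, IsComp β) ∧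
  l.foldr circ [1] = α ∧
  l.IsChain (fun β γ => ¬ IsTrivialPair β γ) ∧
  (∀ β ∈ l, OnlyTrivial β)

/-- `α` is normalised: all factors in its irreducible factorisation are lexicographic minimal. -/
def IsNormalised (α : List ℕ) : Prop :=
  ∃ l : List (List ℕ), IsIrredFactorisation l α ∧ ∀ β ∈ l, IsLexMin β

/-- `α` is normalised, the first factor in its irreducible factorisation is asymmetric,
and all remaining factors are symmetric. -/
def IsNormalisedOne (α : List ℕ) : Prop :=
  ∃ (β : List ℕ) (l : List (List ℕ)), IsIrredFactorisation (β :: l) α ∧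
    (∀ γ ∈ β :: l, IsLexMin γ) ∧ ¬ IsSymm β ∧ ∀ γ ∈ l, IsSymm γ

open Classical in
/-- The generating polynomial, by length, of the compositions of `n` with the property `A`. -/
noncomputable def lengthPoly (A : List ℕ → Prop) (n : ℕ) : Polynomial ℤ :=
  ∑ α : Composition n with A α.blocks, Polynomial.X ^ α.length

/-- `Cₙ(x)`: all compositions of size `n`. -/
noncomputable def C (n : ℕ) : Polynomial ℤ := lengthPoly (fun _ => True) n

/-- `Sₙ(x)`: symmetric compositions of size `n`. -/
noncomputable def S (n : ℕ) : Polynomial ℤ := lengthPoly IsSymm n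

/-- `L^×ₙ(x)`: asymmetric lexicographic minimal compositions of size `n`. -/
noncomputable def Lx (n : ℕ) : Polynomial ℤ := lengthPoly (fun α => ¬ IsSymm α ∧ IsLexMin α) n

/-- `Rₙ(x)`: normalised compositions of size `n`. -/
noncomputable def R (n : ℕ) : Polynomial ℤ := lengthPoly IsNormalised n

/-- `R¹ₙ(x)`: normalised compositions of size `n` whose first irreducible factor is asymmetric
and whose remaining factors are symmetric. -/
noncomputable def R1 (n : ℕ) : Polynomial ℤ := lengthPoly IsNormalisedOne n

/-- `p(x^d)`, as a Laurent polynomial in `x`. -/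
noncomputable def sub (p : Polynomial ℤ) (d : ℕ) : LaurentPolynomial ℤ :=
  Polynomial.toLaurent (p.comp (Polynomial.X ^ d))

/-- The chains `d₀ ∣ d₁ ∣ ⋯ ∣ dₖ ∣ n` with `dᵢ ≠ dᵢ₊₁` for all `i < k`, for positive `n`. -/
def chains (n k : ℕ) : Finset (Fin (k + 1) → ℕ) :=
  {d ∈ Fintype.piFinset (fun _ : Fin (k + 1) => n.divisors) |
    ∀ i : Fin k, d i.castSucc ∣ d i.succ ∧ d i.castSucc ≠ d i.succ}

/-- A chain of divisors of `n` has fewer than `n` steps, so that a sum over all `k ≥ 0` and all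
chains in `chains n k` is a sum over `k < n`. -/
theorem chains_eq_empty {n k : ℕ} (h : n ≤ k) : chains n k = ∅ := by
  rw [Finset.eq_empty_iff_forall_notMem]
  intro d hd
  simp only [chains, Finset.mem_filter, Fintype.mem_piFinset, Nat.mem_divisors] at hd
  obtain ⟨hdiv, hch⟩ := hd
  have hpos : ∀ i, 0 < d i := fun i =>
    Nat.pos_of_dvd_of_pos (hdiv i).1 (Nat.pos_of_ne_zero (hdiv i).2)
  have key : ∀ i : Fin (k + 1), (i : ℕ) + 1 ≤ d i := by
    intro i
    induction i using Fin.induction with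
    | zero => have := hpos 0; simp only [Fin.val_zero]; omega
    | succ i ih =>
      have h1 := Nat.le_of_dvd (hpos _) (hch i).1
      have h2 := (hch i).2
      simp only [Fin.val_castSucc, Fin.val_succ] at ih ⊢
      omega
  have h1 := key (Fin.last k)
  have h2 := Nat.le_of_dvd (Nat.pos_of_ne_zero (hdiv (Fin.last k)).2) (hdiv (Fin.last k)).1
  simp only [Fin.val_last] at h1
  omega

end RibbonComp

/-! Encode a composition of size `n` by `n` letters, join or cut, with a further cut at place 0. The
letter of `α ∘ β` at `j` is that of `α` at `j / |β|` when `|β|` divides `j`, and that of `β` at `j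
mod |β|` otherwise. Hence the size of the right factor determines a factorisation, reversal is
multiplicative, and `α ∘ β` is symmetric iff both factors are.

Now let `A ∘ ρ = B ∘ σ`. If `|ρ|` divides `|σ|`, then `ρ` is a right factor of `σ`
(`exists_circ_of_dvd`). If neither size divides the other, the Chinese remainder theorem makes the
common word so regular that `ρ` and `σ` are symmetric compositions composed with one common right
factor (`exists_circ_of_not_dvd`). The compositions counted by `R1` are therefore the lexicographic
minimal asymmetric ones all of whose proper right factors are symmetric (`isNormalisedOne_iff`), and
a composition has at most one of them as a right factor (`circ_isNormalisedOne_inj`).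

Splitting off this factor, where `|A| = d`, and using `l(A ∘ ρ) = l(A) + d l(ρ) - d`, gives two
recursions over the divisors `d` of `n`: `Lx n` is the sum of `C_d(x) R1_{n/d}(x^d) / x^d`, and `R n
- S n` is the sum of `R_d(x) R1_{n/d}(x^d) / x^d`. The first is solved for its term `d = 1`, where
`C_1 = x`; the second loses its term `d = n`, since `R1_1 = 0`. Unrolling both gives the sums over
chains. -/

namespace RibbonComp

/-! ### Binary words of compositions -/

/-- The binary word of a list of positive integers: each part `a` is written as `a - 1` joins
(`true`) followed by a cut (`false`). -/
def word (α : List ℕ) : List Bool :=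
  α.flatMap fun a => List.replicate (a - 1) true ++ [false]

@[simp] theorem word_nil : word [] = [] := rfl

theorem word_cons (a : ℕ) (α : List ℕ) :
    word (a :: α) = List.replicate (a - 1) true ++ false :: word α := by
  simp [word]

theorem word_append (α β : List ℕ) : word (α ++ β) = word α ++ word β := by
  simp [word]

theorem length_word {α : List ℕ} (h : ∀ a ∈ α, 0 < a) : (word α).length = α.sum := by
  induction α with
  | nil => rfl
  | cons a α ih =>
    have h1 := h a (by simp)
    rw [word_cons]
    simp only [List.length_append, List.length_replicate, List.length_cons, List.sum_cons]
    rw [ih fun x hx => h x (by simp [hx])]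
    omega

theorem count_word (α : List ℕ) : (word α).count false = α.length := by
  induction α with
  | nil => rfl
  | cons a α ih => simp [word_cons, List.count_replicate, ih]

theorem word_ne_nil {α : List ℕ} (h : α ≠ []) : word α ≠ [] := by
  cases α with
  | nil => exact absurd rfl h
  | cons a α => simp [word_cons]

theorem exists_word_eq (w : List Bool) :
    ∃ α : List ℕ, IsComp α ∧ word α = w ++ [false] := by
  induction w with
  | nil => exact ⟨[1], ⟨by simp, by simp⟩, rfl⟩
  | cons b w ih =>
    obtain ⟨α, ⟨hne, hpos⟩, hw⟩ := ih
    cases b with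
    | false =>
      refine ⟨1 :: α, ⟨by simp, ?_⟩, by simp [word_cons, hw]⟩
      simpa using hpos
    | true =>
      cases α with
      | nil => exact absurd rfl hne
      | cons a α =>
        have ha : 0 < a := hpos a (by simp)
        refine ⟨(a + 1) :: α, ⟨by simp, ?_⟩, ?_⟩
        · intro x hx
          rcases List.mem_cons.1 hx with rfl | hx
          · omega
          · exact hpos x (by simp [hx])
        · rw [word_cons] at hw ⊢
          rw [List.cons_append, ← hw]
          obtain ⟨a, rfl⟩ := Nat.exists_eq_succ_of_ne_zero ha.ne'
          simp [List.replicate_succ]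

theorem word_dropLast_append {α : List ℕ} (h : α ≠ []) :
    (word α).dropLast ++ [false] = word α := by
  induction α using List.reverseRecOn with
  | nil => exact absurd rfl h
  | append_singleton l a _ =>
    rw [word_append, word_cons, word_nil, ← List.append_assoc, List.dropLast_concat]

/-- The final cut of a word has no partner at the front; adding one makes reversal of parts an
honest reversal of words. -/
theorem word_reverse (α : List ℕ) : false :: word α.reverse = (false :: word α).reverse := by
  induction α with
  | nil => rfl
  | cons a α ih =>
    have e : false :: word (a :: α) =
        (false :: List.replicate (a - 1) true) ++ (false :: word α) := by
      simp [word_cons]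
    rw [e, List.reverse_append, ← ih]
    simp [word_append, word_cons]

theorem nearConcat_nil : ∀ α : List ℕ, nearConcat α [] = α
  | [] => rfl
  | [_] => rfl
  | a :: a' :: α => by rw [nearConcat, nearConcat_nil (a' :: α)]

theorem word_nearConcat {α β : List ℕ} (hα : α ≠ []) (hβ : β ≠ [])
    (pα : ∀ a ∈ α, 0 < a) (pβ : ∀ a ∈ β, 0 < a) :
    word (nearConcat α β) = (word α).dropLast ++ true :: word β := by
  fun_induction nearConcat α β with
  | case1 => exact absurd rfl hα
  | case2 => exact absurd rfl hβ
  | case3 a b β =>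
    have h1 := pα a (by simp)
    have h2 := pβ b (by simp)
    obtain ⟨a, rfl⟩ := Nat.exists_eq_succ_of_ne_zero h1.ne'
    obtain ⟨b, rfl⟩ := Nat.exists_eq_succ_of_ne_zero h2.ne'
    have e : a + 1 + (b + 1) - 1 = a + (b + 1) := by omega
    simp [word_cons, e, List.replicate_add, List.replicate_succ]
  | case4 a a' α β ih =>
    rw [word_cons, ih (by simp) hβ (fun x hx => pα x (by simp [hx])) pβ, word_cons a,
      List.dropLast_append_of_ne_nil (by simp),
      List.dropLast_cons_of_ne_nil (word_ne_nil (by simp))]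
    simp

theorem nearConcat_ne_nil {α : List ℕ} (β : List ℕ) (hα : α ≠ []) : nearConcat α β ≠ [] := by
  fun_induction nearConcat α β <;> simp_all

theorem nearConcat_pos {α β : List ℕ} (pα : ∀ a ∈ α, 0 < a) (pβ : ∀ a ∈ β, 0 < a) :
    ∀ a ∈ nearConcat α β, 0 < a := by
  fun_induction nearConcat α β with
  | case1 => exact pβ
  | case2 => exact pα
  | case3 a b β =>
    intro x hx
    rcases List.mem_cons.1 hx with rfl | hx
    · have := pα a (by simp)
      omega
    · exact pβ x (by simp [hx])
  | case4 a a' α β ih =>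
    intro x hx
    rcases List.mem_cons.1 hx with rfl | hx
    · exact pα _ (by simp)
    · exact ih (fun y hy => pα y (by simp [hy])) pβ x hx

theorem isComp_nearPow {β : List ℕ} (h : IsComp β) (n : ℕ) : IsComp (nearPow β (n + 1)) := by
  induction n with
  | zero => rw [nearPow, nearPow, nearConcat_nil]; exact h
  | succ n ih => rw [nearPow]; exact ⟨nearConcat_ne_nil _ h.1, nearConcat_pos h.2 ih.2⟩

theorem word_nearPow {β : List ℕ} (h : IsComp β) (n : ℕ) :
    word (nearPow β (n + 1)) =
      (List.replicate n true ++ [false]).flatMap fun t => (word β).dropLast ++ [t] := by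
  induction n with
  | zero =>
    rw [nearPow, nearPow, nearConcat_nil]
    simp [word_dropLast_append h.1]
  | succ n ih =>
    have h1 := isComp_nearPow h n
    rw [nearPow, word_nearConcat h.1 h1.1 h.2 h1.2, ih, List.replicate_succ]
    simp

/-- Each letter `t` of `α` becomes a copy of the word of `β` whose final cut is replaced by `t`: a
join glues consecutive copies, a cut separates them. -/
theorem word_circ {α β : List ℕ} (pα : ∀ a ∈ α, 0 < a) (h : IsComp β) :
    word (circ α β) = (word α).flatMap fun t => (word β).dropLast ++ [t] := by
  induction α with
  | nil => rfl
  | cons a α ih =>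
    have ha := pα a (by simp)
    obtain ⟨a, rfl⟩ := Nat.exists_eq_succ_of_ne_zero ha.ne'
    have e : circ (a.succ :: α) β = nearPow β (a + 1) ++ circ α β := rfl
    rw [e, word_append, word_nearPow h, ih fun x hx => pα x (by simp [hx]), word_cons]
    simp

theorem IsComp.circ {α β : List ℕ} (hα : IsComp α) (hβ : IsComp β) : IsComp (circ α β) := by
  constructor
  · cases α with
    | nil => exact absurd rfl hα.1
    | cons a α =>
      have ha := hα.2 a (by simp)
      obtain ⟨a, rfl⟩ := Nat.exists_eq_succ_of_ne_zero ha.ne'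
      have e : RibbonComp.circ (a.succ :: α) β = nearPow β (a + 1) ++ RibbonComp.circ α β := rfl
      rw [e]
      simp [(isComp_nearPow hβ a).1]
  · intro x hx
    obtain ⟨a, ha, hx⟩ := List.mem_flatMap.1 hx
    obtain ⟨b, rfl⟩ := Nat.exists_eq_succ_of_ne_zero (hα.2 a ha).ne'
    exact (isComp_nearPow hβ b).2 x hx

theorem IsComp.reverse {α : List ℕ} (h : IsComp α) : IsComp α.reverse :=
  ⟨by simpa using h.1, by simpa using h.2⟩

theorem IsComp.sum_pos {α : List ℕ} (h : IsComp α) : 0 < α.sum := by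
  rw [← length_word h.2]
  exact List.length_pos_iff.2 (word_ne_nil h.1)

theorem isComp_one : IsComp [1] := ⟨by simp, by simp⟩

theorem length_flatMap_append_singleton (w B : List Bool) :
    (w.flatMap fun t => B ++ [t]).length = w.length * (B.length + 1) := by
  simp [List.length_flatMap]

theorem sum_circ {α β : List ℕ} (hα : IsComp α) (hβ : IsComp β) :
    (circ α β).sum = α.sum * β.sum := by
  rw [← length_word (hα.circ hβ).2, word_circ hα.2 hβ, length_flatMap_append_singleton,
    length_word hα.2, List.length_dropLast, length_word hβ.2]
  have := hβ.sum_pos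
  congr 1
  omega

theorem count_flatMap_append_singleton (w B : List Bool) :
    (w.flatMap fun t => B ++ [t]).count false = w.length * B.count false + w.count false := by
  induction w with
  | nil => simp
  | cons t w ih =>
    rw [List.flatMap_cons, List.count_append, List.count_append, ih, List.length_cons,
      ← List.singleton_append (l := w), List.count_append]
    ring

/-- Cuts count parts: each of the `|α|` copies of `β` contributes its `l(β) - 1` inner cuts, and the
letters of `α` contribute `l(α)`. The additive form avoids truncated subtraction. -/
theorem length_circ {α β : List ℕ} (hα : IsComp α) (hβ : IsComp β) :
    (circ α β).length + α.sum = α.length + α.sum * β.length := by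
  have h : (word β).dropLast.count false + 1 = β.length := by
    rw [← count_word β]
    conv_rhs => rw [← word_dropLast_append hβ.1]
    simp
  rw [← count_word, word_circ hα.2 hβ, count_flatMap_append_singleton, length_word hα.2,
    count_word, ← h]
  ring

/-! ### Letters by position -/

/-- The `j`-th letter of the binary word of `α`, where the letter at `0` is a cut. -/
def letter (α : List ℕ) (j : ℕ) : Bool := (false :: word α).getD j false

theorem getD_flatMap_append_singleton (w B : List Bool) {q r : ℕ} (hr : r ≤ B.length)
    (hq : q < w.length) :
    (w.flatMap fun t => B ++ [t]).getD (q * (B.length + 1) + r) false =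
      if r = B.length then w.getD q false else B.getD r false := by
  induction w generalizing q with
  | nil => simp at hq
  | cons t w ih =>
    rw [List.flatMap_cons]
    cases q with
    | zero =>
      rw [List.getD_append _ _ _ _ (by simp; omega)]
      split_ifs with h
      · simp [h]
      · rw [List.getD_append _ _ _ _ (by omega)]
        simp
    | succ q =>
      have hq : q < w.length := by simpa using hq
      rw [List.getD_append_right _ _ _ _ (by simp; nlinarith), List.getD_cons_succ]
      have e : (q + 1) * (B.length + 1) + r - (B ++ [t]).length = q * (B.length + 1) + r := by
        rw [List.length_append, List.length_singleton, Nat.succ_mul]; omega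
      rw [e, ih hq]

theorem letter_circ {α β : List ℕ} (hα : IsComp α) (hβ : IsComp β) {j : ℕ}
    (hj : j ≤ α.sum * β.sum) :
    letter (circ α β) j = if β.sum ∣ j then letter α (j / β.sum) else letter β (j % β.sum) := by
  rcases Nat.eq_zero_or_pos j with rfl | h0
  · simp [letter]
  obtain ⟨i, rfl⟩ := Nat.exists_eq_succ_of_ne_zero h0.ne'
  have hb := hβ.sum_pos
  have hB : (word β).dropLast.length + 1 = β.sum := by
    rw [List.length_dropLast, length_word hβ.2]; omega
  have hw : (word β) = (word β).dropLast ++ [false] := (word_dropLast_append hβ.1).symm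
  have hr := Nat.mod_lt i hb
  have hq : i / β.sum < (word α).length := by
    rw [length_word hα.2]
    exact Nat.div_lt_of_lt_mul (by rw [mul_comm]; omega)
  have key := getD_flatMap_append_singleton (word α) (word β).dropLast
    (q := i / β.sum) (r := i % β.sum) (by omega) hq
  rw [hB, Nat.div_add_mod' i β.sum] at key
  rw [letter, List.getD_cons_succ, word_circ hα.2 hβ, key]
  obtain ⟨q, r, hi, hr'⟩ : ∃ q r, i = q * β.sum + r ∧ r < β.sum :=
    ⟨i / β.sum, i % β.sum, (Nat.div_add_mod' i β.sum).symm, hr⟩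
  have e1 : i / β.sum = q := by
    rw [hi, Nat.add_comm, Nat.add_mul_div_right _ _ hb, Nat.div_eq_of_lt hr', Nat.zero_add]
  have e2 : i % β.sum = r := by
    rw [hi, Nat.add_comm, Nat.add_mul_mod_self_right, Nat.mod_eq_of_lt hr']
  rw [e1, e2]
  -- The leading cut shifts indices by one, so the last place of a block, `r = |β| - 1`, is the case
  -- where `|β|` divides `j = i + 1`.
  by_cases h : r = (word β).dropLast.length
  · have e3 : i.succ = (q + 1) * β.sum := by
      rw [Nat.succ_eq_add_one, hi, ← hB, ← h]; ring
    rw [if_pos h, e3, if_pos (dvd_mul_left _ _), Nat.mul_div_cancel _ hb, letter,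
      List.getD_cons_succ]
  · have e3 : i.succ % β.sum = r + 1 := by
      rw [Nat.succ_eq_add_one, hi, Nat.add_assoc, Nat.add_comm, Nat.add_mul_mod_self_right,
        Nat.mod_eq_of_lt (by omega)]
    rw [if_neg h, if_neg (by rw [Nat.dvd_iff_mod_eq_zero, e3]; omega), e3, letter,
      List.getD_cons_succ]
    conv_rhs => rw [hw]
    rw [List.getD_append _ _ _ _ (by omega)]

theorem letter_reverse {α : List ℕ} (h : IsComp α) {j : ℕ} (hj : j ≤ α.sum) :
    letter α.reverse j = letter α (α.sum - j) := by
  rw [letter, word_reverse, List.getD_reverse _ (by simp [length_word h.2]; omega), letter]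
  congr 1
  simp [length_word h.2]

theorem letter_sum {α : List ℕ} (h : IsComp α) : letter α α.sum = false := by
  have := letter_reverse h.reverse (j := α.sum) (by simp)
  simpa [letter] using this

theorem word_injective {α β : List ℕ} (hα : ∀ a ∈ α, 0 < a) (hβ : ∀ a ∈ β, 0 < a)
    (h : word α = word β) : α = β := by
  induction α generalizing β with
  | nil =>
    cases β with
    | nil => rfl
    | cons b β => simp [word_cons] at h
  | cons a α ih =>
    cases β with
    | nil => simp [word_cons] at h
    | cons b β =>
      have ha := hα a (by simp)
      have hb := hβ b (by simp)
      have key : ∀ (m k : ℕ) (u v : List Bool), List.replicate m true ++ false :: u =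
          List.replicate k true ++ false :: v → m = k ∧ u = v := by
        intro m
        induction m with
        | zero => intro k u v h; cases k <;> simp_all [List.replicate_succ]
        | succ m ih =>
          intro k u v h
          cases k with
          | zero => simp [List.replicate_succ] at h
          | succ k =>
            simp only [List.replicate_succ, List.cons_append, List.cons.injEq, true_and] at h
            have := ih k u v h
            exact ⟨by omega, this.2⟩
      rw [word_cons, word_cons] at h
      obtain ⟨h1, h2⟩ := key _ _ _ _ h
      rw [ih (fun x hx => hα x (by simp [hx])) (fun x hx => hβ x (by simp [hx])) h2]
      congr 1
      omega

/-- Only the inner letters carry information: those at 0 and at the size are always cuts. -/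
theorem ext_letter {α β : List ℕ} (hα : IsComp α) (hβ : IsComp β) (hs : α.sum = β.sum)
    (h : ∀ j, 0 < j → j < α.sum → letter α j = letter β j) : α = β := by
  apply word_injective hα.2 hβ.2
  apply List.ext_getElem
  · rw [length_word hα.2, length_word hβ.2, hs]
  · intro i h1 h2
    rw [length_word hα.2] at h1
    have h3 : letter α (i + 1) = letter β (i + 1) := by
      rcases Nat.lt_or_ge (i + 1) α.sum with h4 | h4
      · exact h _ (by omega) h4
      · have e : i + 1 = α.sum := by omega
        rw [e, letter_sum hα, hs, letter_sum hβ]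
    simpa [letter, length_word hα.2, ← hs, h1, h2] using h3

theorem exists_letter (n : ℕ) (hn : 0 < n) (f : ℕ → Bool) :
    ∃ α : List ℕ, IsComp α ∧ α.sum = n ∧ ∀ j, 0 < j → j < n → letter α j = f j := by
  obtain ⟨α, hα, hw⟩ := exists_word_eq ((List.range (n - 1)).map fun i => f (i + 1))
  refine ⟨α, hα, ?_, ?_⟩
  · rw [← length_word hα.2, hw]
    simp
    omega
  · intro j h0 hj
    obtain ⟨i, rfl⟩ := Nat.exists_eq_succ_of_ne_zero h0.ne'
    rw [letter, List.getD_cons_succ, hw, List.getD_append _ _ _ _ (by simp; omega)]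
    have : i < n - 1 := by omega
    simp [List.getD_eq_getElem?_getD, this]


/-! ### Units, associativity, reversal and cancellation -/

theorem isSymm_one : IsSymm [1] := rfl

theorem word_one : word [1] = [false] := rfl

theorem one_circ {β : List ℕ} (hβ : IsComp β) : circ [1] β = β := by
  apply word_injective (isComp_one.circ hβ).2 hβ.2
  rw [word_circ isComp_one.2 hβ, word_one]
  simp [word_dropLast_append hβ.1]

theorem circ_one {α : List ℕ} (hα : IsComp α) : circ α [1] = α := by
  apply word_injective (hα.circ isComp_one).2 hα.2
  rw [word_circ hα.2 isComp_one, word_one]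
  simp

theorem circ_assoc {α β γ : List ℕ} (hα : IsComp α) (hβ : IsComp β) (hγ : IsComp γ) :
    circ (circ α β) γ = circ α (circ β γ) := by
  apply word_injective ((hα.circ hβ).circ hγ).2 (hα.circ (hβ.circ hγ)).2
  have h : (word (circ β γ)).dropLast =
      ((word β).dropLast.flatMap fun t => (word γ).dropLast ++ [t]) ++ (word γ).dropLast := by
    rw [word_circ hβ.2 hγ]
    conv_lhs => rw [← word_dropLast_append hβ.1]
    rw [List.flatMap_append, List.flatMap_singleton, ← List.append_assoc, List.dropLast_concat]
  rw [word_circ (hα.circ hβ).2 hγ, word_circ hα.2 hβ, word_circ hα.2 (hβ.circ hγ), h,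
    List.flatMap_assoc]
  simp

/-- The reflection `j ↦ |α||β| - j` preserves multiples of `|β|`, acting on quotients as the
reflection of `α`, and sends a nonzero residue `r` to `|β| - r`, the reflection of `β`. -/
theorem reverse_circ {α β : List ℕ} (hα : IsComp α) (hβ : IsComp β) :
    (circ α β).reverse = circ α.reverse β.reverse := by
  have hs := sum_circ hα hβ
  have hb := hβ.sum_pos
  apply ext_letter (hα.circ hβ).reverse (hα.reverse.circ hβ.reverse)
  · rw [sum_circ hα.reverse hβ.reverse, List.sum_reverse, List.sum_reverse, List.sum_reverse, hs]
  intro j h0 hj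
  rw [List.sum_reverse, hs] at hj
  rw [letter_reverse (hα.circ hβ) (by omega), letter_circ hα hβ (by omega),
    letter_circ hα.reverse hβ.reverse (by simpa using hj.le), hs, List.sum_reverse]
  by_cases hd : β.sum ∣ j
  · obtain ⟨q, rfl⟩ := hd
    have hq : q ≤ α.sum := by nlinarith
    have e : α.sum * β.sum - β.sum * q = β.sum * (α.sum - q) := by
      rw [Nat.mul_sub, Nat.mul_comm]
    rw [e, if_pos (dvd_mul_right _ _), if_pos (dvd_mul_right _ _), Nat.mul_div_cancel_left _ hb,
      Nat.mul_div_cancel_left _ hb, letter_reverse hα hq]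
  · have hd' : ¬ β.sum ∣ α.sum * β.sum - j := fun h =>
      hd ((Nat.dvd_sub_iff_right hj.le (dvd_mul_left _ _)).1 h)
    have hm := Nat.mod_lt j hb
    have hm0 : j % β.sum ≠ 0 := fun h => hd (Nat.dvd_of_mod_eq_zero h)
    have e : (α.sum * β.sum - j) % β.sum = β.sum - j % β.sum := by
      have h1 := Nat.div_add_mod' j β.sum
      have h2 : j / β.sum < α.sum := Nat.div_lt_of_lt_mul (by rwa [mul_comm])
      obtain ⟨c, hc⟩ := Nat.exists_eq_add_of_lt h2
      have h3 : α.sum * β.sum = j / β.sum * β.sum + c * β.sum + β.sum := by rw [hc]; ring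
      have h4 : α.sum * β.sum - j = (β.sum - j % β.sum) + c * β.sum := by omega
      rw [h4, Nat.add_mul_mod_self_right, Nat.mod_eq_of_lt (by omega)]
    rw [if_neg hd, if_neg hd', e, letter_reverse hβ hm.le]

theorem letter_circ_mul {α β : List ℕ} (hα : IsComp α) (hβ : IsComp β) {j : ℕ}
    (hj : j ≤ α.sum) : letter (circ α β) (j * β.sum) = letter α j := by
  rw [letter_circ hα hβ (Nat.mul_le_mul_right _ hj), if_pos (dvd_mul_left _ _),
    Nat.mul_div_cancel _ hβ.sum_pos]

theorem letter_circ_of_lt {α β : List ℕ} (hα : IsComp α) (hβ : IsComp β) {j : ℕ}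
    (hj : j < β.sum) : letter (circ α β) j = letter β j := by
  have := hα.sum_pos
  rw [letter_circ hα hβ (by nlinarith), Nat.mod_eq_of_lt hj]
  split_ifs with h
  · rw [Nat.eq_zero_of_dvd_of_lt h hj]
    simp [letter]
  · rfl

/-- The left factor is read off at the multiples of `|β|`, the right factor on the initial segment
below `|β|`. -/
theorem circ_inj {α β α' β' : List ℕ} (hα : IsComp α) (hβ : IsComp β) (hα' : IsComp α')
    (hβ' : IsComp β') (h : circ α β = circ α' β') (hs : β.sum = β'.sum) : α = α' ∧ β = β' := by
  have hsum := congrArg List.sum h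
  rw [sum_circ hα hβ, sum_circ hα' hβ', hs] at hsum
  have hs' := Nat.eq_of_mul_eq_mul_right hβ'.sum_pos hsum
  constructor
  · apply ext_letter hα hα' hs'
    intro j _ hj
    rw [← letter_circ_mul hα hβ hj.le, h, hs, letter_circ_mul hα' hβ' (hs' ▸ hj.le)]
  · apply ext_letter hβ hβ' hs
    intro j _ hj
    rw [← letter_circ_of_lt hα hβ hj, h, letter_circ_of_lt hα' hβ' (hs ▸ hj)]

theorem isSymm_circ {α β : List ℕ} (hα : IsComp α) (hβ : IsComp β) :
    IsSymm (circ α β) ↔ IsSymm α ∧ IsSymm β := by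
  rw [IsSymm, reverse_circ hα hβ]
  constructor
  · intro h
    exact circ_inj hα.reverse hβ.reverse hα hβ h (List.sum_reverse β)
  · rintro ⟨h1, h2⟩
    rw [h1, h2]

theorem eq_one_of_sum {α : List ℕ} (hα : IsComp α) (h : α.sum = 1) : α = [1] :=
  ext_letter hα isComp_one h fun j h0 h1 => by omega

theorem one_lt_sum {α : List ℕ} (hα : IsComp α) (h : α ≠ [1]) : 1 < α.sum := by
  have := hα.sum_pos
  have : α.sum ≠ 1 := fun h' => h (eq_one_of_sum hα h')
  omega

/-! ### Comparing two factorisations of one composition -/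

/-- Take for `δ` the letters of `σ` at multiples of `|ρ|`. Elsewhere `σ` agrees with the common
word, hence with copies of `ρ`; cancelling `ρ` then yields `A`. -/
theorem exists_circ_of_dvd {A B ρ σ : List ℕ} (hA : IsComp A) (hB : IsComp B) (hρ : IsComp ρ)
    (hσ : IsComp σ) (h : circ A ρ = circ B σ) (hd : ρ.sum ∣ σ.sum) :
    ∃ δ, IsComp δ ∧ σ = circ δ ρ ∧ A = circ B δ := by
  obtain ⟨m, hm⟩ := hd
  have hc := hρ.sum_pos
  have hm0 : 0 < m := Nat.pos_of_mul_pos_left (hm ▸ hσ.sum_pos)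
  obtain ⟨δ, hδ, hs, hl⟩ := exists_letter m hm0 fun j => letter σ (j * ρ.sum)
  have e : σ = circ δ ρ := by
    apply ext_letter hσ (hδ.circ hρ) (by rw [sum_circ hδ hρ, hs, hm, mul_comm])
    intro j h0 hj
    have hj' : j < m * ρ.sum := by rwa [mul_comm, ← hm]
    rw [letter_circ hδ hρ (by rw [hs]; exact hj'.le)]
    split_ifs with hdj
    · obtain ⟨q, rfl⟩ := hdj
      rw [Nat.mul_div_cancel_left _ hc, hl q (Nat.pos_of_mul_pos_left h0) (by nlinarith), mul_comm]
    · have hle : j ≤ A.sum * ρ.sum := by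
        have := congrArg List.sum h
        rw [sum_circ hA hρ, sum_circ hB hσ] at this
        have := hB.sum_pos
        nlinarith
      rw [← letter_circ_of_lt hB hσ hj, ← h, letter_circ hA hρ hle, if_neg hdj]
  refine ⟨δ, hδ, e, ?_⟩
  rw [e, ← circ_assoc hB hδ hρ] at h
  exact (circ_inj hA hρ (hB.circ hδ) hρ h rfl).1

theorem isSymm_of_letter {κ : List ℕ} (hκ : IsComp κ) (u : Bool)
    (h : ∀ j, 0 < j → j < κ.sum → letter κ j = u) : IsSymm κ := by
  apply ext_letter hκ.reverse hκ (List.sum_reverse κ)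
  intro j h0 hj
  rw [List.sum_reverse] at hj
  rw [letter_reverse hκ hj.le, h _ (by omega) (by omega), h _ h0 hj]

/-- Letters of a word with two right factors of sizes `c` and `d` agree at places that are
congruent modulo `gcd c d`, when the first is no multiple of `c`, and the second none of `d`. -/
theorem letter_eq_of_modEq {A B ρ σ : List ℕ} (hA : IsComp A) (hB : IsComp B) (hρ : IsComp ρ)
    (hσ : IsComp σ) (h : circ A ρ = circ B σ) {i j : ℕ}
    (hi : i ≤ (circ A ρ).sum) (hj : j ≤ (circ A ρ).sum)
    (hci : ¬ ρ.sum ∣ i) (hdj : ¬ σ.sum ∣ j) (hij : i ≡ j [MOD Nat.gcd ρ.sum σ.sum]) :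
    letter (circ A ρ) i = letter (circ A ρ) j := by
  have hc := hρ.sum_pos
  have hd := hσ.sum_pos
  have h1 := sum_circ hA hρ
  have h2 := sum_circ hB hσ
  rw [← h] at h2
  -- A place `k` congruent to `i` modulo `|ρ|` and to `j` modulo `|σ|` links the two letters. Being
  -- below the lcm of the sizes, it lies within the word.
  obtain ⟨k, hk⟩ : ∃ k, k = Nat.chineseRemainder' hij := ⟨_, rfl⟩
  have hlt := Nat.chineseRemainder'_lt_lcm hij hc.ne' hd.ne'
  rw [← hk] at hlt
  have hkle : (k : ℕ) ≤ (circ A ρ).sum :=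
    hlt.le.trans (Nat.le_of_dvd (hA.circ hρ).sum_pos
      (Nat.lcm_dvd (h1 ▸ dvd_mul_left _ _) (h2 ▸ dvd_mul_left _ _)))
  have hkc : (k : ℕ) ≡ i [MOD ρ.sum] := k.2.1
  have hkd : (k : ℕ) ≡ j [MOD σ.sum] := k.2.2
  have e1 : letter (circ A ρ) i = letter (circ A ρ) k := by
    rw [letter_circ hA hρ (h1 ▸ hi), letter_circ hA hρ (h1 ▸ hkle), if_neg hci,
      if_neg (fun hh => hci ((hkc.dvd_iff dvd_rfl).1 hh)), hkc]
  have e2 : letter (circ A ρ) j = letter (circ A ρ) k := by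
    rw [h, letter_circ hB hσ (h2 ▸ hj), letter_circ hB hσ (h2 ▸ hkle), if_neg hdj,
      if_neg (fun hh => hdj ((hkd.dvd_iff dvd_rfl).1 hh)), hkd]
  rw [e1, e2]

/-- Let `g` be the gcd of the two sizes, and `τ` the composition of size `g` read off from the start
of the common word. Off the multiples of `g` the word repeats `τ`; at the multiples of `g` inside
`ρ` or inside `σ` it is constant. So `κ` and `κ'` have constant inner letters, which makes them
symmetric. `κ = [1]` would give `|ρ| = g`, a divisor of `|σ|`. -/
theorem exists_circ_of_not_dvd {A B ρ σ : List ℕ} (hA : IsComp A) (hB : IsComp B) (hρ : IsComp ρ)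
    (hσ : IsComp σ) (h : circ A ρ = circ B σ) (hcd : ¬ ρ.sum ∣ σ.sum) (hdc : ¬ σ.sum ∣ ρ.sum) :
    ∃ τ κ κ', IsComp τ ∧ IsComp κ ∧ IsComp κ' ∧ IsSymm κ ∧ IsSymm κ' ∧
      ρ = circ κ τ ∧ σ = circ κ' τ ∧ κ ≠ [1] := by
  have hc := hρ.sum_pos
  have hd := hσ.sum_pos
  obtain ⟨g, hg⟩ : ∃ g, g = Nat.gcd ρ.sum σ.sum := ⟨_, rfl⟩
  have hg0 : 0 < g := hg ▸ Nat.gcd_pos_of_pos_left _ hc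
  have hgc : g ∣ ρ.sum := hg ▸ Nat.gcd_dvd_left _ _
  have hgd : g ∣ σ.sum := hg ▸ Nat.gcd_dvd_right _ _
  have hgc' : ¬ ρ.sum ∣ g := fun hh => hcd (hh.trans hgd)
  have hgd' : ¬ σ.sum ∣ g := fun hh => hdc (hh.trans hgc)
  have h1 := sum_circ hA hρ
  have h2 := sum_circ hB hσ
  rw [← h] at h2
  have hcn : ρ.sum ≤ (circ A ρ).sum := by have := hA.sum_pos; nlinarith
  have hdn : σ.sum ≤ (circ A ρ).sum := by have := hB.sum_pos; nlinarith
  have hgle : g ≤ (circ A ρ).sum := (Nat.le_of_dvd hc hgc).trans hcn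
  -- values at multiples of `g` and at the other places
  have hmulc : ∀ q, ¬ ρ.sum ∣ q * g → q * g ≤ (circ A ρ).sum →
      letter (circ A ρ) (q * g) = letter (circ A ρ) g := fun q hq hle =>
    letter_eq_of_modEq hA hB hρ hσ h hle hgle hq hgd'
      (by rw [← hg]; simp [Nat.ModEq])
  have hmuld : ∀ q, ¬ σ.sum ∣ q * g → q * g ≤ (circ A ρ).sum →
      letter (circ A ρ) (q * g) = letter (circ A ρ) g := fun q hq hle =>
    (letter_eq_of_modEq hA hB hρ hσ h hgle hle hgc' hq
      (by rw [← hg]; simp [Nat.ModEq])).symm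
  have hmod : ∀ j, ¬ g ∣ j → j ≤ (circ A ρ).sum →
      letter (circ A ρ) j = letter (circ A ρ) (j % g) := fun j hj hle =>
    letter_eq_of_modEq hA hB hρ hσ h hle ((Nat.mod_lt _ hg0).le.trans hgle)
      (fun hh => hj (hgc.trans hh))
      (fun hh => hj ((Nat.dvd_mod_iff dvd_rfl).1 (hgd.trans hh)))
      (by rw [← hg]; exact (Nat.mod_modEq j g).symm)
  obtain ⟨τ, hτ, hτs, hτl⟩ := exists_letter g hg0 (letter (circ A ρ))
  have main : ∀ ρ' : List ℕ, IsComp ρ' → g ∣ ρ'.sum → ρ'.sum ≤ (circ A ρ).sum →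
      (∀ j, j < ρ'.sum → letter ρ' j = letter (circ A ρ) j) →
      (∀ q, ¬ ρ'.sum ∣ q * g → q * g ≤ (circ A ρ).sum →
        letter (circ A ρ) (q * g) = letter (circ A ρ) g) →
      ∃ κ, IsComp κ ∧ IsSymm κ ∧ ρ' = circ κ τ := by
    intro ρ' hρ' hgρ hle hlow hmul
    obtain ⟨m, hm⟩ := hgρ
    have hm0 : 0 < m := Nat.pos_of_mul_pos_left (hm ▸ hρ'.sum_pos)
    obtain ⟨κ, hκ, hκs, hκl⟩ := exists_letter m hm0 fun _ => letter (circ A ρ) g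
    refine ⟨κ, hκ, isSymm_of_letter hκ _ (hκs ▸ hκl), ?_⟩
    have hs : ρ'.sum = (circ κ τ).sum := by rw [sum_circ hκ hτ, hκs, hτs, hm, mul_comm]
    apply ext_letter hρ' (hκ.circ hτ) hs
    intro j h0 hj
    rw [letter_circ hκ hτ (by rw [← sum_circ hκ hτ, ← hs]; exact hj.le), hτs, hlow j hj]
    split_ifs with hgj
    · obtain ⟨q, rfl⟩ := hgj
      have hq0 : 0 < q := Nat.pos_of_mul_pos_left h0
      rw [Nat.mul_div_cancel_left _ hg0, hκl q hq0 (by nlinarith), mul_comm,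
        hmul q (fun hh => ?_) (by rw [mul_comm]; omega)]
      rw [mul_comm] at hh
      exact absurd (Nat.le_of_dvd h0 hh) (by omega)
    · have := Nat.mod_lt j hg0
      rw [hτl _ (Nat.pos_of_ne_zero fun hh => hgj (Nat.dvd_of_mod_eq_zero hh)) this,
        hmod j hgj (by omega)]
  obtain ⟨κ, hκ, hκs, hκe⟩ := main ρ hρ hgc hcn
    (fun j hj => (letter_circ_of_lt hA hρ hj).symm) hmulc
  obtain ⟨κ', hκ', hκs', hκe'⟩ := main σ hσ hgd hdn
    (fun j hj => by rw [h, letter_circ_of_lt hB hσ hj]) hmuld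
  refine ⟨τ, κ, κ', hτ, hκ, hκ', hκs, hκs', hκe, hκe', ?_⟩
  rintro rfl
  apply hgc'
  rw [hκe, one_circ hτ, hτs]

/-! ### Lexicographic order through letters -/

theorem letter_cons_add {a : ℕ} (ha : 0 < a) (α : List ℕ) (j : ℕ) :
    letter (a :: α) (a + j) = letter α j := by
  have e : false :: word (a :: α) =
      (false :: List.replicate (a - 1) true) ++ (false :: word α) := by
    simp [word_cons]
  have hl : (false :: List.replicate (a - 1) true).length = a := by simp; omega
  rw [letter, e, List.getD_append_right _ _ _ _ (by omega), hl, Nat.add_sub_cancel_left, letter]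

theorem letter_cons_of_lt {a : ℕ} (α : List ℕ) {j : ℕ} (h0 : 0 < j) (hj : j < a) :
    letter (a :: α) j = true := by
  obtain ⟨i, rfl⟩ := Nat.exists_eq_succ_of_ne_zero h0.ne'
  rw [letter, List.getD_cons_succ, word_cons, List.getD_append _ _ _ _ (by simp; omega)]
  have : i < a - 1 := by omega
  simp [List.getD_eq_getElem?_getD, this]

/-- At the first differing part the smaller one ends earlier, with a cut where the larger still
joins. Equal sizes exclude proper prefixes. -/
theorem exists_letter_of_lt {α β : List ℕ} (hα : ∀ a ∈ α, 0 < a) (hβ : ∀ a ∈ β, 0 < a)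
    (hs : α.sum = β.sum) (h : α < β) :
    ∃ j < α.sum, (∀ i < j, letter α i = letter β i) ∧
      letter α j = false ∧ letter β j = true := by
  induction α generalizing β with
  | nil =>
    cases β with
    | nil => exact absurd h (lt_irrefl _)
    | cons b β =>
      have := hβ b (by simp)
      simp at hs
      omega
  | cons a α ih =>
    cases β with
    | nil => exact absurd h (List.not_lt_nil _)
    | cons b β =>
      have ha := hα a (by simp)
      have hb := hβ b (by simp)
      rw [List.sum_cons, List.sum_cons] at hs
      rcases List.cons_lt_cons_iff.1 h with hab | ⟨rfl, hlt⟩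
      · refine ⟨a, ?_, ?_, ?_, letter_cons_of_lt β ha hab⟩
        · rw [List.sum_cons]
          rcases α with _ | ⟨x, α⟩
          · simp at hs
            omega
          · have := hα x (by simp)
            rw [List.sum_cons]
            omega
        · intro i hi
          rcases Nat.eq_zero_or_pos i with rfl | h0
          · simp [letter]
          · rw [letter_cons_of_lt α h0 hi, letter_cons_of_lt β h0 (hi.trans hab)]
        · have := letter_cons_add ha α 0
          simpa [letter] using this
      · obtain ⟨j, hj, h1, h2, h3⟩ := ih (fun x hx => hα x (by simp [hx]))
          (fun x hx => hβ x (by simp [hx])) (by omega) hlt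
        refine ⟨a + j, by simpa using hj, ?_, by rw [letter_cons_add ha, h2],
          by rw [letter_cons_add ha, h3]⟩
        intro i hi
        rcases Nat.lt_or_ge i a with hia | hia
        · rcases Nat.eq_zero_or_pos i with rfl | h0
          · simp [letter]
          · rw [letter_cons_of_lt α h0 hia, letter_cons_of_lt β h0 hia]
        · obtain ⟨k, rfl⟩ := Nat.exists_eq_add_of_le hia
          rw [letter_cons_add ha, letter_cons_add ha, h1 k (by omega)]

theorem lt_of_letter {α β : List ℕ} (hα : ∀ a ∈ α, 0 < a) (hβ : ∀ a ∈ β, 0 < a)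
    (hs : α.sum = β.sum) {j : ℕ} (h1 : ∀ i < j, letter α i = letter β i)
    (h2 : letter α j = false) (h3 : letter β j = true) : α < β := by
  rcases lt_trichotomy α β with h | rfl | h
  · exact h
  · simp [h2] at h3
  · obtain ⟨k, -, k1, k2, k3⟩ := exists_letter_of_lt hβ hα hs.symm h
    rcases lt_trichotomy j k with hjk | rfl | hjk
    · simp [k1 j hjk, h2] at h3
    · simp [h2] at k3
    · simp [← h1 k hjk, k3] at k2

theorem circ_lt_circ_right {α α' β β' : List ℕ} (hα : IsComp α) (hα' : IsComp α')
    (hβ : IsComp β) (hβ' : IsComp β') (hs : α.sum = α'.sum) (hs' : β.sum = β'.sum) (h : β < β') :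
    circ α β < circ α' β' := by
  obtain ⟨j, hj, h1, h2, h3⟩ := exists_letter_of_lt hβ.2 hβ'.2 hs' h
  refine lt_of_letter (hα.circ hβ).2 (hα'.circ hβ').2
    (by rw [sum_circ hα hβ, sum_circ hα' hβ', hs, hs']) (j := j) ?_ ?_ ?_
  · intro i hi
    rw [letter_circ_of_lt hα hβ (hi.trans hj), letter_circ_of_lt hα' hβ' (hs' ▸ hi.trans hj),
      h1 i hi]
  · rw [letter_circ_of_lt hα hβ hj, h2]
  · rw [letter_circ_of_lt hα' hβ' (hs' ▸ hj), h3]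

theorem circ_lt_circ_left {α α' β : List ℕ} (hα : IsComp α) (hα' : IsComp α')
    (hβ : IsComp β) (hs : α.sum = α'.sum) (h : α < α') : circ α β < circ α' β := by
  obtain ⟨j, hj, h1, h2, h3⟩ := exists_letter_of_lt hα.2 hα'.2 hs h
  have hb := hβ.sum_pos
  refine lt_of_letter (hα.circ hβ).2 (hα'.circ hβ).2
    (by rw [sum_circ hα hβ, sum_circ hα' hβ, hs]) (j := j * β.sum) ?_ ?_ ?_
  · intro i hi
    have hi' : i ≤ α.sum * β.sum := hi.le.trans (Nat.mul_le_mul_right _ hj.le)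
    rw [letter_circ hα hβ hi', letter_circ hα' hβ (hs ▸ hi')]
    split_ifs with hd
    · exact h1 _ (Nat.div_lt_of_lt_mul (by rwa [mul_comm]))
    · rfl
  · rw [letter_circ_mul hα hβ hj.le, h2]
  · rw [letter_circ_mul hα' hβ (hs ▸ hj.le), h3]

theorem isLexMin_of_isSymm {α : List ℕ} (h : IsSymm α) : IsLexMin α := by
  rw [IsLexMin, h]

theorem lt_reverse_of_isLexMin {α : List ℕ} (h : IsLexMin α) (hs : ¬ IsSymm α) :
    α < α.reverse :=
  lt_of_le_of_ne h fun e => hs e.symm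

theorem reverse_lt_of_not_isLexMin {α : List ℕ} (h : ¬ IsLexMin α) : α.reverse < α :=
  not_le.1 h

/-- The word of `α ∘ β` starts with that of `β`, so an asymmetric `β` already decides the comparison
with the reversal. -/
theorem isLexMin_circ_of_not_isSymm {α β : List ℕ} (hα : IsComp α) (hβ : IsComp β)
    (hs : ¬ IsSymm β) : IsLexMin (circ α β) ↔ IsLexMin β := by
  constructor
  · intro h
    by_contra hn
    have h1 := circ_lt_circ_right hα.reverse hα hβ.reverse hβ (List.sum_reverse α)
      (List.sum_reverse β) (reverse_lt_of_not_isLexMin hn)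
    rw [← reverse_circ hα hβ] at h1
    exact absurd h (not_le.2 h1)
  · intro h
    have h1 := circ_lt_circ_right hα hα.reverse hβ hβ.reverse (List.sum_reverse α).symm
      (List.sum_reverse β).symm (lt_reverse_of_isLexMin h hs)
    rw [← reverse_circ hα hβ] at h1
    exact h1.le

/-- With `β` symmetric, `α ∘ β` and its reversal can differ only at multiples of `|β|`, where the
letters are those of `α` and its reversal. -/
theorem isLexMin_circ_of_isSymm {α β : List ℕ} (hα : IsComp α) (hβ : IsComp β)
    (hs : IsSymm β) : IsLexMin (circ α β) ↔ IsLexMin α := by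
  by_cases hα' : IsSymm α
  · exact iff_of_true (isLexMin_of_isSymm ((isSymm_circ hα hβ).2 ⟨hα', hs⟩))
      (isLexMin_of_isSymm hα')
  constructor
  · intro h
    by_contra hn
    have h1 := circ_lt_circ_left hα.reverse hα hβ (List.sum_reverse α)
      (reverse_lt_of_not_isLexMin hn)
    nth_rw 1 [← hs] at h1
    rw [← reverse_circ hα hβ] at h1
    exact absurd h (not_le.2 h1)
  · intro h
    have h1 := circ_lt_circ_left hα hα.reverse hβ (List.sum_reverse α).symm
      (lt_reverse_of_isLexMin h hα')
    nth_rw 2 [← hs] at h1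
    rw [← reverse_circ hα hβ] at h1
    exact h1.le


/-! ### Irreducible factorisations -/

theorem isComp_foldr {l : List (List ℕ)} (h : ∀ β ∈ l, IsComp β) : IsComp (l.foldr circ [1]) := by
  induction l with
  | nil => exact isComp_one
  | cons β l ih => exact (h β (by simp)).circ (ih fun γ hγ => h γ (by simp [hγ]))

theorem foldr_circ_append {l l' : List (List ℕ)} (h : ∀ β ∈ l, IsComp β)
    (h' : ∀ β ∈ l', IsComp β) :
    (l ++ l').foldr circ [1] = circ (l.foldr circ [1]) (l'.foldr circ [1]) := by
  induction l with
  | nil => rw [List.nil_append, List.foldr_nil, one_circ (isComp_foldr h')]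
  | cons β l ih =>
    have hl : ∀ γ ∈ l, IsComp γ := fun γ hγ => h γ (by simp [hγ])
    rw [List.cons_append, List.foldr_cons, List.foldr_cons, ih hl,
      circ_assoc (h β (by simp)) (isComp_foldr hl) (isComp_foldr h')]

theorem isSymm_foldr {l : List (List ℕ)} (h : ∀ β ∈ l, IsComp β) :
    IsSymm (l.foldr circ [1]) ↔ ∀ β ∈ l, IsSymm β := by
  induction l with
  | nil => simp [isSymm_one]
  | cons β l ih =>
    have hl : ∀ γ ∈ l, IsComp γ := fun γ hγ => h γ (by simp [hγ])
    rw [List.foldr_cons, isSymm_circ (h β (by simp)) (isComp_foldr hl), ih hl]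
    simp

theorem length_le_sum {α : List ℕ} (h : ∀ a ∈ α, 0 < a) : α.length ≤ α.sum := by
  rw [← length_word h, ← count_word]
  exact List.count_le_length

theorem length_eq_sum_iff {α : List ℕ} (h : ∀ a ∈ α, 0 < a) :
    α.length = α.sum ↔ ∀ a ∈ α, a = 1 := by
  induction α with
  | nil => simp
  | cons a α ih =>
    have ha := h a (by simp)
    have hα : ∀ x ∈ α, 0 < x := fun x hx => h x (by simp [hx])
    have := length_le_sum hα
    rw [List.forall_mem_cons, ← ih hα, List.length_cons, List.sum_cons]
    omega

theorem IsComp.length_pos {α : List ℕ} (h : IsComp α) : 0 < α.length :=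
  List.length_pos_iff.2 h.1

theorem length_circ_eq_one_iff {β γ : List ℕ} (hβ : IsComp β) (hγ : IsComp γ) :
    (circ β γ).length = 1 ↔ β.length = 1 ∧ γ.length = 1 := by
  have h := length_circ hβ hγ
  have h1 := hβ.length_pos
  have h2 := hγ.length_pos
  have h3 := hβ.sum_pos
  constructor
  · intro h4
    have h5 : γ.length = 1 := by
      by_contra h6
      have : 2 ≤ γ.length := by omega
      have : β.sum * 2 ≤ β.sum * γ.length := Nat.mul_le_mul_left _ this
      omega
    rw [h5] at h
    omega
  · rintro ⟨h4, h5⟩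
    rw [h4, h5] at h
    omega

theorem forall_mem_circ_eq_one_iff {β γ : List ℕ} (hβ : IsComp β) (hγ : IsComp γ) :
    (∀ a ∈ circ β γ, a = 1) ↔ (∀ b ∈ β, b = 1) ∧ ∀ c ∈ γ, c = 1 := by
  rw [← length_eq_sum_iff (hβ.circ hγ).2, ← length_eq_sum_iff hβ.2, ← length_eq_sum_iff hγ.2,
    sum_circ hβ hγ]
  have h := length_circ hβ hγ
  have h1 := length_le_sum hβ.2
  have h2 := length_le_sum hγ.2
  have h3 := hβ.sum_pos
  constructor
  · intro h4
    have h5 : γ.length = γ.sum := by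
      by_contra h6
      have : γ.length + 1 ≤ γ.sum := by omega
      have : β.sum * (γ.length + 1) ≤ β.sum * γ.sum := Nat.mul_le_mul_left _ this
      rw [Nat.mul_succ] at this
      have := hβ.length_pos
      omega
    rw [h5] at h
    omega
  · rintro ⟨h4, h5⟩
    rw [h4, h5] at h
    omega

theorem onlyTrivial_of_length {α : List ℕ} (h : α.length = 1) : OnlyTrivial α := by
  rintro β γ hβ hγ rfl
  exact Or.inr (Or.inl ((length_circ_eq_one_iff hβ hγ).1 h))

theorem onlyTrivial_of_forall_mem {α : List ℕ} (h : ∀ a ∈ α, a = 1) : OnlyTrivial α := by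
  rintro β γ hβ hγ rfl
  exact Or.inr (Or.inr ((forall_mem_circ_eq_one_iff hβ hγ).1 h))

/-- This allows trivial neighbours to be merged into one factor. -/
theorem IsTrivialPair.onlyTrivial_circ {β γ : List ℕ} (h : IsTrivialPair β γ) (hβ : IsComp β)
    (hγ : IsComp γ) (oβ : OnlyTrivial β) (oγ : OnlyTrivial γ) : OnlyTrivial (circ β γ) := by
  rcases h with (rfl | rfl) | h | h
  · rwa [one_circ hγ]
  · rwa [circ_one hβ]
  · exact onlyTrivial_of_length ((length_circ_eq_one_iff hβ hγ).2 h)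
  · exact onlyTrivial_of_forall_mem ((forall_mem_circ_eq_one_iff hβ hγ).2 h)

theorem isSymm_of_length {α : List ℕ} (h : α.length = 1) : IsSymm α := by
  obtain ⟨a, rfl⟩ := List.length_eq_one_iff.1 h
  rfl

theorem isSymm_of_forall_mem {α : List ℕ} (h : ∀ a ∈ α, a = 1) : IsSymm α := by
  rw [List.eq_replicate_of_mem h, IsSymm, List.reverse_replicate]

/-- Hence an asymmetric factor never forms a trivial pair with a factor other than `[1]`. -/
theorem IsTrivialPair.isSymm {β γ : List ℕ} (h : IsTrivialPair β γ) (hβ : β ≠ [1])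
    (hγ : γ ≠ [1]) : IsSymm β ∧ IsSymm γ := by
  rcases h with (h | h) | h | h
  · exact absurd h hβ
  · exact absurd h hγ
  · exact ⟨isSymm_of_length h.1, isSymm_of_length h.2⟩
  · exact ⟨isSymm_of_forall_mem h.1, isSymm_of_forall_mem h.2⟩

theorem ne_one_of_not_isSymm {α : List ℕ} (h : ¬ IsSymm α) : α ≠ [1] := by
  rintro rfl
  exact h isSymm_one

theorem sum_lt_sum_circ {β γ : List ℕ} (hβ : IsComp β) (hγ : IsComp γ) (h : β ≠ [1]) :
    γ.sum < (circ β γ).sum := by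
  rw [sum_circ hβ hγ]
  have := one_lt_sum hβ h
  have := hγ.sum_pos
  nlinarith

theorem exists_onlyTrivial_list {α : List ℕ} (hα : IsComp α) :
    ∃ l : List (List ℕ), l ≠ [] ∧ (∀ β ∈ l, IsComp β) ∧ l.foldr circ [1] = α ∧
      ∀ β ∈ l, OnlyTrivial β := by
  obtain ⟨n, hn⟩ : ∃ n, n = α.sum := ⟨_, rfl⟩
  induction n using Nat.strong_induction_on generalizing α with
  | _ n ih =>
    by_cases h : OnlyTrivial α
    · exact ⟨[α], by simp, by simpa using hα, by simp [circ_one hα], by simpa using h⟩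
    · simp only [OnlyTrivial, not_forall] at h
      obtain ⟨β, γ, hβ, hγ, rfl, h⟩ := h
      have hβ1 : β ≠ [1] := fun e => h (Or.inl (Or.inl e))
      have hγ1 : γ ≠ [1] := fun e => h (Or.inl (Or.inr e))
      have hlt := sum_lt_sum_circ hβ hγ hβ1
      have hlt' : β.sum < (circ β γ).sum := by
        rw [sum_circ hβ hγ]
        have := one_lt_sum hγ hγ1
        have := hβ.sum_pos
        nlinarith
      obtain ⟨l, h1, h2, rfl, h4⟩ := ih _ (hn ▸ hlt') hβ rfl
      obtain ⟨l', h1', h2', rfl, h4'⟩ := ih _ (hn ▸ hlt) hγ rfl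
      refine ⟨l ++ l', by simp [h1], ?_, foldr_circ_append h2 h2', ?_⟩
      · exact List.forall_mem_append.2 ⟨h2, h2'⟩
      · exact List.forall_mem_append.2 ⟨h4, h4'⟩

/-- Among the factorisations into factors with only trivial factorisations, a shortest one works:
merging a trivial neighbouring pair would shorten it. -/
theorem exists_isIrredFactorisation {α : List ℕ} (hα : IsComp α) :
    ∃ l, IsIrredFactorisation l α := by
  classical
  have hex : ∃ m, ∃ l : List (List ℕ), (l ≠ [] ∧ (∀ β ∈ l, IsComp β) ∧ l.foldr circ [1] = α ∧
      ∀ β ∈ l, OnlyTrivial β) ∧ l.length = m := by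
    obtain ⟨l, hl⟩ := exists_onlyTrivial_list hα
    exact ⟨_, l, hl, rfl⟩
  obtain ⟨l, ⟨h1, h2, h3, h4⟩, hlen⟩ := Nat.find_spec hex
  refine ⟨l, h1, h2, h3, ?_, h4⟩
  rw [List.isChain_iff_forall_rel_of_append_cons_cons]
  rintro β γ l₁ l₂ rfl htriv
  simp only [List.forall_mem_append, List.forall_mem_cons] at h2 h4
  obtain ⟨c₁, cβ, cγ, c₂⟩ := h2
  obtain ⟨o₁, oβ, oγ, o₂⟩ := h4
  refine Nat.find_min hex (m := (l₁ ++ circ β γ :: l₂).length) (by rw [← hlen]; simp)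
    ⟨l₁ ++ circ β γ :: l₂, ⟨by simp, ?_, ?_, ?_⟩, rfl⟩
  · simp only [List.forall_mem_append, List.forall_mem_cons]
    exact ⟨c₁, cβ.circ cγ, c₂⟩
  · rw [← h3]
    simp only [List.foldr_append, List.foldr_cons]
    rw [circ_assoc cβ cγ (isComp_foldr c₂)]
  · simp only [List.forall_mem_append, List.forall_mem_cons]
    exact ⟨o₁, htriv.onlyTrivial_circ cβ cγ oβ oγ, o₂⟩

theorem eq_singleton_of_one_mem {l : List (List ℕ)}
    (h : l.IsChain fun β γ => ¬ IsTrivialPair β γ) (h1 : [1] ∈ l) : l = [[1]] := by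
  obtain ⟨s, t, rfl⟩ := List.append_of_mem h1
  rw [List.isChain_iff_forall_rel_of_append_cons_cons] at h
  cases t with
  | cons c t => exact absurd (Or.inl (Or.inl rfl)) (h rfl)
  | nil =>
    rcases List.eq_nil_or_concat s with rfl | ⟨s, b, rfl⟩
    · rfl
    · exact absurd (Or.inl (Or.inr rfl)) (h (a := b) (b := [1]) (l₁ := s) (l₂ := []) (by simp))

theorem IsIrredFactorisation.isComp {l : List (List ℕ)} {α : List ℕ}
    (h : IsIrredFactorisation l α) : IsComp α := h.2.2.1 ▸ isComp_foldr h.2.1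

/-! ### Minimal asymmetric right factors -/

/-- This frees the property from any choice of irreducible factorisation, so uniqueness of the
latter is never needed. -/
theorem isNormalisedOne_iff {ρ : List ℕ} : IsNormalisedOne ρ ↔
    IsComp ρ ∧ ¬ IsSymm ρ ∧ IsLexMin ρ ∧
      ∀ γ δ, IsComp γ → IsComp δ → circ γ δ = ρ → γ ≠ [1] → IsSymm δ := by
  constructor
  · rintro ⟨β, l, hirr, hmin, hβs, hls⟩
    have hρ := hirr.isComp
    obtain ⟨-, hc, rfl, -, ho⟩ := hirr
    have hβ := hc β (by simp)
    have hl : ∀ γ ∈ l, IsComp γ := fun γ hγ => hc γ (by simp [hγ])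
    have hσ := isComp_foldr hl
    have hσs := (isSymm_foldr hl).2 hls
    rw [List.foldr_cons] at *
    refine ⟨hρ, fun h => hβs ((isSymm_circ hβ hσ).1 h).1,
      (isLexMin_circ_of_isSymm hβ hσ hσs).2 (hmin β (by simp)), ?_⟩
    intro γ δ hγ hδ he hγ1
    -- The right factor `δ` is compared with the symmetric product `σ` of the tail. It divides `σ`;
    -- or `δ = ε ∘ σ` with `β = γ ∘ ε`, where `ε ≠ [1]` would make the asymmetric `β` symmetric; or
    -- both share a right factor `τ`, symmetric because `σ` is.
    by_cases h1 : δ.sum ∣ (l.foldr circ [1]).sum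
    · obtain ⟨ε, hε, e, -⟩ := exists_circ_of_dvd hγ hβ hδ hσ he h1
      rw [e] at hσs
      exact ((isSymm_circ hε hδ).1 hσs).2
    by_cases h2 : (l.foldr circ [1]).sum ∣ δ.sum
    · obtain ⟨ε, hε, e, e'⟩ := exists_circ_of_dvd hβ hγ hσ hδ he.symm h2
      by_cases hε1 : ε = [1]
      · rw [e, hε1, one_circ hσ]
        exact hσs
      · have := (ho β (by simp) γ ε hγ hε e'.symm).isSymm hγ1 hε1
        exact absurd (e' ▸ (isSymm_circ hγ hε).2 this) hβs
    · obtain ⟨τ, κ, κ', hτ, hκ, hκ', sκ, sκ', e, e', -⟩ :=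
        exists_circ_of_not_dvd hγ hβ hδ hσ he h1 h2
      rw [e'] at hσs
      rw [e]
      exact (isSymm_circ hκ hτ).2 ⟨sκ, ((isSymm_circ hκ' hτ).1 hσs).2⟩
  · rintro ⟨hρ, hs, hm, hr⟩
    obtain ⟨l, hirr⟩ := exists_isIrredFactorisation hρ
    cases l with
    | nil => exact absurd rfl hirr.1
    | cons β l =>
      have hirr' := hirr
      obtain ⟨-, hc, rfl, hch, ho⟩ := hirr'
      have hβ := hc β (by simp)
      have hl : ∀ γ ∈ l, IsComp γ := fun γ hγ => hc γ (by simp [hγ])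
      have hσ := isComp_foldr hl
      rw [List.foldr_cons] at *
      have hσs : IsSymm (l.foldr circ [1]) := by
        by_cases hβ1 : β = [1]
        · cases l with
          | nil => exact isSymm_one
          | cons γ l =>
            rw [List.isChain_cons_cons] at hch
            exact absurd (Or.inl (Or.inl hβ1)) hch.1
        · exact hr β _ hβ hσ rfl hβ1
      have hβs : ¬ IsSymm β := fun h => hs ((isSymm_circ hβ hσ).2 ⟨h, hσs⟩)
      have hls := (isSymm_foldr hl).1 hσs
      refine ⟨β, l, hirr, ?_, hβs, hls⟩
      exact List.forall_mem_cons.2 ⟨(isLexMin_circ_of_isSymm hβ hσ hσs).1 hm,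
        fun γ hγ => isLexMin_of_isSymm (hls γ hγ)⟩

/-- If the sizes differed, minimality would make `ρ` or `σ` symmetric, through a proper right factor
of one of them. -/
theorem circ_isNormalisedOne_inj {A B ρ σ : List ℕ} (hA : IsComp A) (hB : IsComp B)
    (hρ : IsNormalisedOne ρ) (hσ : IsNormalisedOne σ) (h : circ A ρ = circ B σ) :
    A = B ∧ ρ = σ := by
  obtain ⟨cρ, sρ, -, rρ⟩ := isNormalisedOne_iff.1 hρ
  obtain ⟨cσ, sσ, -, rσ⟩ := isNormalisedOne_iff.1 hσ
  have key : ρ.sum = σ.sum := by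
    by_cases h1 : ρ.sum ∣ σ.sum
    · obtain ⟨δ, hδ, e, -⟩ := exists_circ_of_dvd hA hB cρ cσ h h1
      by_cases hδ1 : δ = [1]
      · rw [e, hδ1, one_circ cρ]
      · exact absurd (rσ δ ρ hδ cρ e.symm hδ1) sρ
    by_cases h2 : σ.sum ∣ ρ.sum
    · obtain ⟨δ, hδ, e, -⟩ := exists_circ_of_dvd hB hA cσ cρ h.symm h2
      by_cases hδ1 : δ = [1]
      · rw [e, hδ1, one_circ cσ]
      · exact absurd (rρ δ σ hδ cσ e.symm hδ1) sσ
    · obtain ⟨τ, κ, κ', hτ, hκ, hκ', sκ, sκ', e, -, hκ1⟩ :=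
        exists_circ_of_not_dvd hA hB cρ cσ h h1 h2
      exact absurd (e ▸ (isSymm_circ hκ hτ).2 ⟨sκ, rρ κ τ hκ hτ e.symm hκ1⟩) sρ
  exact circ_inj hA cρ hB cσ h key

theorem exists_minimal_asymmetric_factor {α : List ℕ} (hα : IsComp α) (hs : ¬ IsSymm α) :
    ∃ A ρ, IsComp A ∧ IsComp ρ ∧ circ A ρ = α ∧ ¬ IsSymm ρ ∧
      ∀ γ δ, IsComp γ → IsComp δ → circ γ δ = ρ → γ ≠ [1] → IsSymm δ := by
  obtain ⟨n, hn⟩ : ∃ n, n = α.sum := ⟨_, rfl⟩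
  induction n using Nat.strong_induction_on generalizing α with
  | _ n ih =>
    by_cases h : ∀ γ δ, IsComp γ → IsComp δ → circ γ δ = α → γ ≠ [1] → IsSymm δ
    · exact ⟨[1], α, isComp_one, hα, one_circ hα, hs, h⟩
    · simp only [not_forall] at h
      obtain ⟨γ, δ, hγ, hδ, rfl, hγ1, hδs⟩ := h
      obtain ⟨A, ρ, hA, hρ, rfl, h1, h2⟩ := ih _ (hn ▸ sum_lt_sum_circ hγ hδ hγ1) hδ hδs rfl
      exact ⟨circ γ A, ρ, hγ.circ hA, hρ, circ_assoc hγ hA hρ, h1, h2⟩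

theorem not_isSymm_and_isLexMin_iff {α : List ℕ} (hα : IsComp α) :
    (¬ IsSymm α ∧ IsLexMin α) ↔
      ∃ A ρ, IsComp A ∧ IsNormalisedOne ρ ∧ circ A ρ = α := by
  constructor
  · rintro ⟨hs, hm⟩
    obtain ⟨A, ρ, hA, hρ, rfl, h1, h2⟩ := exists_minimal_asymmetric_factor hα hs
    exact ⟨A, ρ, hA, isNormalisedOne_iff.2
      ⟨hρ, h1, (isLexMin_circ_of_not_isSymm hA hρ h1).1 hm, h2⟩, rfl⟩
  · rintro ⟨A, ρ, hA, hρ, rfl⟩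
    obtain ⟨cρ, sρ, mρ, -⟩ := isNormalisedOne_iff.1 hρ
    exact ⟨fun h => sρ ((isSymm_circ hA cρ).1 h).2, (isLexMin_circ_of_not_isSymm hA cρ sρ).2 mρ⟩

theorem IsNormalised.isComp {α : List ℕ} (h : IsNormalised α) : IsComp α := by
  obtain ⟨l, h, -⟩ := h
  exact h.isComp

theorem IsNormalisedOne.isComp {α : List ℕ} (h : IsNormalisedOne α) : IsComp α :=
  (isNormalisedOne_iff.1 h).1

theorem isNormalised_of_isSymm {α : List ℕ} (hα : IsComp α) (h : IsSymm α) : IsNormalised α := by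
  obtain ⟨l, hl⟩ := exists_isIrredFactorisation hα
  refine ⟨l, hl, fun β hβ => isLexMin_of_isSymm ?_⟩
  rw [← hl.2.2.1] at h
  exact (isSymm_foldr hl.2.1).1 h β hβ

theorem exists_last_of_not_forall {ι : Type*} {p : ι → Prop} {l : List ι} (h : ¬ ∀ a ∈ l, p a) :
    ∃ l₁ a l₂, l = l₁ ++ a :: l₂ ∧ ¬ p a ∧ ∀ b ∈ l₂, p b := by
  induction l with
  | nil => simp at h
  | cons a l ih =>
    by_cases hl : ∀ b ∈ l, p b
    · exact ⟨[], a, l, rfl, fun ha => h (List.forall_mem_cons.2 ⟨ha, hl⟩), hl⟩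
    · obtain ⟨l₁, b, l₂, rfl, hb⟩ := ih hl
      exact ⟨a :: l₁, b, l₂, rfl, hb⟩

/-- Cut the factorisation just before its last asymmetric factor. Conversely, two factorisations may
be joined: the asymmetric head of the second keeps the junction nontrivial. -/
theorem isNormalised_and_not_isSymm_iff {α : List ℕ} :
    (IsNormalised α ∧ ¬ IsSymm α) ↔
      ∃ A ρ, IsNormalised A ∧ IsNormalisedOne ρ ∧ circ A ρ = α := by
  constructor
  · rintro ⟨⟨l, ⟨-, hc, rfl, hch, ho⟩, hm⟩, hs⟩
    rw [isSymm_foldr hc] at hs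
    obtain ⟨l₁, β, l₂, rfl, hβ, hl₂⟩ := exists_last_of_not_forall hs
    rw [List.forall_mem_append] at hc hm ho
    obtain ⟨ch₁, ch₂, -⟩ := List.isChain_append.1 hch
    refine ⟨l₁.foldr circ [1], (β :: l₂).foldr circ [1], ?_, ?_,
      (foldr_circ_append hc.1 hc.2).symm⟩
    · by_cases h1 : l₁ = []
      · rw [h1]
        exact isNormalised_of_isSymm isComp_one isSymm_one
      · exact ⟨l₁, ⟨h1, hc.1, rfl, ch₁, ho.1⟩, hm.1⟩
    · exact ⟨β, l₂, ⟨by simp, hc.2, rfl, ch₂, ho.2⟩, hm.2, hβ, hl₂⟩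
  · rintro ⟨A, ρ, hA, hρ, rfl⟩
    have cA := hA.isComp
    have cρ := hρ.isComp
    refine ⟨?_, fun h => (isNormalisedOne_iff.1 hρ).2.1 ((isSymm_circ cA cρ).1 h).2⟩
    obtain ⟨β, l', ⟨-, hc', rfl, hch', ho'⟩, hm', hβ, -⟩ := hρ
    obtain ⟨l, ⟨hne, hc, rfl, hch, ho⟩, hm⟩ := hA
    -- A factor `[1]` would make the junction trivial, but it occurs only when `A = [1]`.
    by_cases h1 : [1] ∈ l
    · obtain rfl := eq_singleton_of_one_mem hch h1
      rw [List.foldr_cons, List.foldr_nil, circ_one isComp_one, one_circ cρ]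
      exact ⟨β :: l', ⟨by simp, hc', rfl, hch', ho'⟩, hm'⟩
    · refine ⟨l ++ β :: l', ⟨by simp, List.forall_mem_append.2 ⟨hc, hc'⟩,
        foldr_circ_append hc hc', ?_, List.forall_mem_append.2 ⟨ho, ho'⟩⟩,
        List.forall_mem_append.2 ⟨hm, hm'⟩⟩
      refine List.isChain_append.2 ⟨hch, hch', ?_⟩
      intro γ hγ δ hδ htriv
      obtain rfl : β = δ := by simpa using hδ
      have hγl : γ ∈ l := List.mem_of_getLast? hγ
      exact hβ (htriv.isSymm (fun e => h1 (e ▸ hγl)) (ne_one_of_not_isSymm hβ)).2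


/-! ### Generating polynomials and divisor recursions -/

open Classical in
/-- The compositions of `n` with the property `A`, as a finite set of lists. -/
noncomputable def compsWith (A : List ℕ → Prop) (n : ℕ) : Finset (List ℕ) :=
  ({α : Composition n | A α.blocks} : Finset (Composition n)).image Composition.blocks

theorem mem_compsWith {A : List ℕ → Prop} {n : ℕ} (hn : 0 < n) {α : List ℕ} :
    α ∈ compsWith A n ↔ IsComp α ∧ α.sum = n ∧ A α := by
  simp only [compsWith, Finset.mem_image, Finset.mem_filter, Finset.mem_univ, true_and]
  constructor
  · rintro ⟨c, hc, rfl⟩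
    refine ⟨⟨?_, fun a ha => c.blocks_pos ha⟩, c.blocks_sum, hc⟩
    intro h
    have := c.blocks_sum
    rw [h] at this
    simp at this
    omega
  · rintro ⟨h, hs, hA⟩
    exact ⟨⟨α, fun {i} hi => h.2 i hi, hs⟩, hA, rfl⟩

theorem lengthPoly_eq_sum (A : List ℕ → Prop) (n : ℕ) :
    lengthPoly A n = ∑ α ∈ compsWith A n, Polynomial.X ^ α.length := by
  rw [compsWith, Finset.sum_image]
  · rfl
  · intro c _ c' _ h
    exact Composition.ext h

theorem sub_lengthPoly (A : List ℕ → Prop) (n d : ℕ) :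
    sub (lengthPoly A n) d = ∑ α ∈ compsWith A n, LaurentPolynomial.T ((d : ℤ) * α.length) := by
  rw [sub, lengthPoly_eq_sum, Polynomial.comp, Polynomial.eval₂_finsetSum, map_sum]
  refine Finset.sum_congr rfl fun α _ => ?_
  rw [← Polynomial.comp, Polynomial.X_pow_comp, ← pow_mul, Polynomial.toLaurent_X_pow, Nat.cast_mul]

theorem sub_one (p : Polynomial ℤ) : sub p 1 = Polynomial.toLaurent p := by
  rw [sub, pow_one, Polynomial.comp_X]

/-- Unique factorisation of the compositions with the property `P` into a composition with the
property `P₁` and one with the property `P₂`, on the level of generating polynomials. -/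
theorem sub_lengthPoly_eq_sum {P P₁ P₂ : List ℕ → Prop}
    (h : ∀ α, IsComp α → (P α ↔ ∃ A ρ, IsComp A ∧ P₁ A ∧ IsComp ρ ∧ P₂ ρ ∧ circ A ρ = α))
    (hinj : ∀ A ρ B σ, IsComp A → IsComp B → P₂ ρ → P₂ σ → circ A ρ = circ B σ → A = B ∧ ρ = σ)
    {n : ℕ} (hn : 0 < n) (a : ℕ) :
    sub (lengthPoly P n) a = ∑ d ∈ n.divisors,
      sub (lengthPoly P₁ d) a *
        (sub (lengthPoly P₂ (n / d)) (a * d) * LaurentPolynomial.T (-((a * d : ℕ) : ℤ))) := by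
  have hdiv : ∀ d ∈ n.divisors, 0 < d ∧ 0 < n / d ∧ d * (n / d) = n := fun d hd => by
    have h1 := Nat.dvd_of_mem_divisors hd
    have h2 := Nat.pos_of_dvd_of_pos h1 hn
    exact ⟨h2, Nat.div_pos (Nat.le_of_dvd hn h1) h2, Nat.mul_div_cancel' h1⟩
  have hterm : ∀ d ∈ n.divisors, sub (lengthPoly P₁ d) a *
        (sub (lengthPoly P₂ (n / d)) (a * d) * LaurentPolynomial.T (-((a * d : ℕ) : ℤ))) =
      ∑ p ∈ compsWith P₁ d ×ˢ compsWith P₂ (n / d),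
        (LaurentPolynomial.T ((a : ℤ) * (circ p.1 p.2).length) : LaurentPolynomial ℤ) := by
    intro d hd
    obtain ⟨h1, h2, -⟩ := hdiv d hd
    rw [sub_lengthPoly, sub_lengthPoly, ← mul_assoc, Finset.sum_mul_sum, Finset.sum_mul,
      Finset.sum_product]
    refine Finset.sum_congr rfl fun A hA => ?_
    rw [Finset.sum_mul]
    refine Finset.sum_congr rfl fun ρ hρ => ?_
    obtain ⟨cA, sA, -⟩ := (mem_compsWith h1).1 hA
    obtain ⟨cρ, -, -⟩ := (mem_compsWith h2).1 hρ
    rw [← LaurentPolynomial.T_add, ← LaurentPolynomial.T_add]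
    congr 1
    have := length_circ cA cρ
    rw [sA] at this
    have h3 : ((circ A ρ).length : ℤ) = A.length + d * ρ.length - d := by
      rw [eq_sub_iff_add_eq]
      exact_mod_cast this
    simp only [h3]
    push_cast
    ring
  rw [Finset.sum_congr rfl hterm, Finset.sum_sigma', sub_lengthPoly]
  symm
  refine Finset.sum_bij (fun x _ => circ x.2.1 x.2.2) ?_ ?_ ?_ fun _ _ => rfl
  · rintro ⟨d, A, ρ⟩ hx
    obtain ⟨hd, hx⟩ := Finset.mem_sigma.1 hx
    obtain ⟨hA, hρ⟩ := Finset.mem_product.1 hx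
    obtain ⟨h1, h2, h3⟩ := hdiv d hd
    obtain ⟨cA, sA, pA⟩ := (mem_compsWith h1).1 hA
    obtain ⟨cρ, sρ, pρ⟩ := (mem_compsWith h2).1 hρ
    dsimp only at *
    exact (mem_compsWith hn).2 ⟨cA.circ cρ, by rw [sum_circ cA cρ, sA, sρ, h3],
      (h _ (cA.circ cρ)).2 ⟨A, ρ, cA, pA, cρ, pρ, rfl⟩⟩
  · rintro ⟨d, A, ρ⟩ hx ⟨d', A', ρ'⟩ hx' he
    obtain ⟨hd, hx⟩ := Finset.mem_sigma.1 hx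
    obtain ⟨hA, hρ⟩ := Finset.mem_product.1 hx
    obtain ⟨hd', hx'⟩ := Finset.mem_sigma.1 hx'
    obtain ⟨hA', hρ'⟩ := Finset.mem_product.1 hx'
    obtain ⟨cA, sA, -⟩ := (mem_compsWith (hdiv d hd).1).1 hA
    obtain ⟨-, -, pρ⟩ := (mem_compsWith (hdiv d hd).2.1).1 hρ
    obtain ⟨cA', sA', -⟩ := (mem_compsWith (hdiv d' hd').1).1 hA'
    obtain ⟨-, -, pρ'⟩ := (mem_compsWith (hdiv d' hd').2.1).1 hρ'
    dsimp only at *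
    obtain ⟨rfl, rfl⟩ := hinj _ _ _ _ cA cA' pρ pρ' he
    rw [← sA, ← sA']
  · intro α hα
    obtain ⟨cα, sα, pα⟩ := (mem_compsWith hn).1 hα
    obtain ⟨A, ρ, cA, pA, cρ, pρ, rfl⟩ := (h α cα).1 pα
    rw [sum_circ cA cρ] at sα
    have hd : A.sum ∣ n := ⟨_, sα.symm⟩
    have hd' : n / A.sum = ρ.sum := by rw [← sα, Nat.mul_div_cancel_left _ cA.sum_pos]
    refine ⟨⟨A.sum, A, ρ⟩, Finset.mem_sigma.2 ⟨Nat.mem_divisors.2 ⟨hd, hn.ne'⟩,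
      Finset.mem_product.2 ⟨?_, ?_⟩⟩, rfl⟩
    · exact (mem_compsWith cA.sum_pos).2 ⟨cA, rfl, pA⟩
    · dsimp only
      rw [hd']
      exact (mem_compsWith cρ.sum_pos).2 ⟨cρ, rfl, pρ⟩

theorem sub_Lx {n : ℕ} (hn : 0 < n) (a : ℕ) :
    sub (Lx n) a = ∑ d ∈ n.divisors, sub (C d) a *
      (sub (R1 (n / d)) (a * d) * LaurentPolynomial.T (-((a * d : ℕ) : ℤ))) := by
  refine sub_lengthPoly_eq_sum (fun α hα => ?_) (fun A ρ B σ hA hB hρ hσ =>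
    circ_isNormalisedOne_inj hA hB hρ hσ) hn a
  rw [not_isSymm_and_isLexMin_iff hα]
  exact ⟨fun ⟨A, ρ, hA, hρ, e⟩ => ⟨A, ρ, hA, trivial, hρ.isComp, hρ, e⟩,
    fun ⟨A, ρ, hA, _, _, hρ, e⟩ => ⟨A, ρ, hA, hρ, e⟩⟩

/-- Symmetric compositions are normalised, since all their irreducible factors are symmetric. -/
theorem R_eq_add {n : ℕ} (hn : 0 < n) :
    R n = S n + lengthPoly (fun α => IsNormalised α ∧ ¬ IsSymm α) n := by
  classical
  rw [R, S, lengthPoly_eq_sum, lengthPoly_eq_sum, lengthPoly_eq_sum, ← Finset.sum_union]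
  · refine Finset.sum_congr ?_ fun _ _ => rfl
    ext α
    rw [Finset.mem_union, mem_compsWith hn, mem_compsWith hn, mem_compsWith hn]
    have := @isNormalised_of_isSymm α
    tauto
  · rw [Finset.disjoint_left]
    intro α h1 h2
    exact ((mem_compsWith hn).1 h2).2.2.2 ((mem_compsWith hn).1 h1).2.2

theorem toLaurent_R {n : ℕ} (hn : 0 < n) :
    Polynomial.toLaurent (R n) = Polynomial.toLaurent (S n) +
      ∑ d ∈ n.divisors, Polynomial.toLaurent (R d) *
        (sub (R1 (n / d)) d * LaurentPolynomial.T (-(d : ℤ))) := by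
  have h := sub_lengthPoly_eq_sum (P := fun α => IsNormalised α ∧ ¬ IsSymm α)
    (P₁ := IsNormalised) (P₂ := IsNormalisedOne) (fun α hα => by
      rw [isNormalised_and_not_isSymm_iff]
      exact ⟨fun ⟨A, ρ, hA, hρ, e⟩ => ⟨A, ρ, hA.isComp, hA, hρ.isComp, hρ, e⟩,
        fun ⟨A, ρ, _, hA, _, hρ, e⟩ => ⟨A, ρ, hA, hρ, e⟩⟩)
    (fun A ρ B σ hA hB hρ hσ => circ_isNormalisedOne_inj hA hB hρ hσ) hn 1
  simp only [sub_one, one_mul] at h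
  rw [R_eq_add hn, map_add, h]
  rfl

theorem C_one : C 1 = Polynomial.X := by
  have : compsWith (fun _ => True) 1 = {[1]} := by
    ext α
    rw [mem_compsWith one_pos, Finset.mem_singleton]
    exact ⟨fun h => eq_one_of_sum h.1 h.2.1, fun h => h ▸ ⟨isComp_one, rfl, trivial⟩⟩
  rw [C, lengthPoly_eq_sum, this]
  simp

theorem R1_one : R1 1 = 0 := by
  rw [R1, lengthPoly_eq_sum]
  refine Finset.sum_eq_zero fun α hα => ?_
  obtain ⟨h1, h2, h3⟩ := (mem_compsWith one_pos).1 hα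
  rw [eq_one_of_sum h1 h2] at h3
  exact absurd isSymm_one (isNormalisedOne_iff.1 h3).2.1

/-! ### Unrolling recursions into sums over chains -/

section Chains

variable {M : Type*} [CommRing M]

theorem mem_chains {n k : ℕ} {d : Fin (k + 1) → ℕ} : d ∈ chains n k ↔
    (∀ i, d i ∈ n.divisors) ∧ ∀ i : Fin k, d i.castSucc ∣ d i.succ ∧ d i.castSucc ≠ d i.succ := by
  rw [chains, Finset.mem_filter, Fintype.mem_piFinset]

theorem cons_mem_chains {n k a : ℕ} {d : Fin (k + 1) → ℕ} :
    (Fin.cons a d : Fin (k + 2) → ℕ) ∈ chains n (k + 1) ↔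
      a ∈ n.divisors ∧ (a ∣ d 0 ∧ a ≠ d 0) ∧ d ∈ chains n k := by
  rw [mem_chains, mem_chains, Fin.forall_fin_succ, Fin.forall_fin_succ (P := fun i : Fin (k + 1) =>
    (Fin.cons a d : Fin (k + 2) → ℕ) i.castSucc ∣ (Fin.cons a d : Fin (k + 2) → ℕ) i.succ ∧ _)]
  simp only [Fin.cons_zero, Fin.cons_succ, Fin.castSucc_zero, ← Fin.succ_castSucc]
  tauto

theorem snoc_mem_chains {n k e : ℕ} {d : Fin (k + 1) → ℕ} :
    (Fin.snoc d e : Fin (k + 2) → ℕ) ∈ chains n (k + 1) ↔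
      e ∈ n.divisors ∧ (d (Fin.last k) ∣ e ∧ d (Fin.last k) ≠ e) ∧ d ∈ chains n k := by
  rw [mem_chains, mem_chains, Fin.forall_fin_succ', Fin.forall_fin_succ' (P := fun i : Fin (k + 1) =>
    (Fin.snoc d e : Fin (k + 2) → ℕ) i.castSucc ∣ (Fin.snoc d e : Fin (k + 2) → ℕ) i.succ ∧ _)]
  simp only [Fin.snoc_last, Fin.snoc_castSucc, Fin.succ_last, Fin.succ_castSucc]
  tauto

/-- The weighted sum over the chains of `k` steps that start at `a`. -/
def chainSumFrom (n : ℕ) (V : ℕ → M) (w : ℕ → ℕ → M) (k a : ℕ) : M :=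
  ∑ d ∈ chains n k with d 0 = a, V (d (Fin.last k)) * ∏ i : Fin k, w (d i.castSucc) (d i.succ)

/-- The weighted sum over the chains of `k` steps that end at `e`. -/
def chainSumTo (n : ℕ) (V : ℕ → M) (w : ℕ → ℕ → M) (k e : ℕ) : M :=
  ∑ d ∈ chains n k with d (Fin.last k) = e, V (d 0) * ∏ i : Fin k, w (d i.castSucc) (d i.succ)

theorem chains_zero_filter {n a : ℕ} (ha : a ∈ n.divisors) :
    ({d ∈ chains n 0 | d 0 = a} : Finset (Fin 1 → ℕ)) = {fun _ => a} := by
  ext d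
  rw [Finset.mem_filter, mem_chains, Finset.mem_singleton]
  constructor
  · rintro ⟨-, rfl⟩
    ext i
    rw [Subsingleton.elim i 0]
  · rintro rfl
    exact ⟨⟨fun _ => ha, fun i => i.elim0⟩, rfl⟩

theorem chainSumFrom_zero {n a : ℕ} (V : ℕ → M) (w : ℕ → ℕ → M) (ha : a ∈ n.divisors) :
    chainSumFrom n V w 0 a = V a := by
  rw [chainSumFrom, chains_zero_filter ha, Finset.sum_singleton]
  simp

theorem chainSumTo_zero {n e : ℕ} (V : ℕ → M) (w : ℕ → ℕ → M) (he : e ∈ n.divisors) :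
    chainSumTo n V w 0 e = V e := by
  rw [chainSumTo, Fin.last_zero, chains_zero_filter he, Finset.sum_singleton]
  simp

/-- Removing the first entry `a` leaves a chain that starts at some proper multiple `b` of `a`. -/
theorem chainSumFrom_succ {n a : ℕ} (V : ℕ → M) (w : ℕ → ℕ → M) (k : ℕ) (ha : a ∈ n.divisors) :
    chainSumFrom n V w (k + 1) a =
      ∑ b ∈ n.divisors with a ∣ b ∧ a ≠ b, w a b * chainSumFrom n V w k b := by
  have h : ∀ b ∈ ({b ∈ n.divisors | a ∣ b ∧ a ≠ b} : Finset ℕ), w a b * chainSumFrom n V w k b =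
      ∑ d ∈ ({d ∈ chains n k | a ∣ d 0 ∧ a ≠ d 0} : Finset _) with d 0 = b,
        w a (d 0) * (V (d (Fin.last k)) * ∏ i : Fin k, w (d i.castSucc) (d i.succ)) := by
    intro b hb
    obtain ⟨-, hb⟩ := Finset.mem_filter.1 hb
    rw [chainSumFrom, Finset.mul_sum, Finset.filter_filter]
    refine Finset.sum_congr (Finset.filter_congr fun d _ => ?_) fun d hd => ?_
    · constructor
      · rintro rfl
        exact ⟨hb, rfl⟩
      · exact fun h => h.2
    · rw [(Finset.mem_filter.1 hd).2.2]
  rw [Finset.sum_congr rfl h, Finset.sum_fiberwise_of_maps_to]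
  · rw [chainSumFrom]
    refine Finset.sum_nbij' (fun d => Fin.tail d) (fun d => Fin.cons a d) ?_ ?_ ?_ ?_ ?_
    · intro d hd
      obtain ⟨h1, rfl⟩ := Finset.mem_filter.1 hd
      rw [← Fin.cons_self_tail d, cons_mem_chains] at h1
      exact Finset.mem_filter.2 ⟨h1.2.2, h1.2.1⟩
    · intro d hd
      obtain ⟨hd, h1⟩ := Finset.mem_filter.1 hd
      exact Finset.mem_filter.2 ⟨cons_mem_chains.2 ⟨ha, h1, hd⟩, rfl⟩
    · intro d hd
      obtain ⟨-, rfl⟩ := Finset.mem_filter.1 hd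
      exact Fin.cons_self_tail d
    · intro d _
      exact Fin.tail_cons _ _
    · intro d hd
      obtain ⟨-, rfl⟩ := Finset.mem_filter.1 hd
      rw [Fin.prod_univ_succ]
      simp only [Fin.tail, Fin.succ_last, Fin.castSucc_zero, Fin.succ_castSucc]
      ring
  · intro d hd
    obtain ⟨hd, h1⟩ := Finset.mem_filter.1 hd
    exact Finset.mem_filter.2 ⟨(mem_chains.1 hd).1 0, h1⟩

theorem chainSumTo_succ {n e : ℕ} (V : ℕ → M) (w : ℕ → ℕ → M) (k : ℕ) (he : e ∈ n.divisors) :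
    chainSumTo n V w (k + 1) e =
      ∑ b ∈ n.divisors with b ∣ e ∧ b ≠ e, chainSumTo n V w k b * w b e := by
  have h : ∀ b ∈ ({b ∈ n.divisors | b ∣ e ∧ b ≠ e} : Finset ℕ), chainSumTo n V w k b * w b e =
      ∑ d ∈ ({d ∈ chains n k | d (Fin.last k) ∣ e ∧ d (Fin.last k) ≠ e} : Finset _)
          with d (Fin.last k) = b,
        V (d 0) * (∏ i : Fin k, w (d i.castSucc) (d i.succ)) * w (d (Fin.last k)) e := by
    intro b hb
    obtain ⟨-, hb⟩ := Finset.mem_filter.1 hb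
    rw [chainSumTo, Finset.sum_mul, Finset.filter_filter]
    refine Finset.sum_congr (Finset.filter_congr fun d _ => ?_) fun d hd => ?_
    · constructor
      · rintro rfl
        exact ⟨hb, rfl⟩
      · exact fun h => h.2
    · rw [(Finset.mem_filter.1 hd).2.2]
  rw [Finset.sum_congr rfl h, Finset.sum_fiberwise_of_maps_to]
  · rw [chainSumTo]
    refine Finset.sum_nbij' (fun d => Fin.init d) (fun d => Fin.snoc d e) ?_ ?_ ?_ ?_ ?_
    · intro d hd
      obtain ⟨h1, rfl⟩ := Finset.mem_filter.1 hd
      rw [← Fin.snoc_init_self d, snoc_mem_chains] at h1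
      exact Finset.mem_filter.2 ⟨h1.2.2, h1.2.1⟩
    · intro d hd
      obtain ⟨hd, h1⟩ := Finset.mem_filter.1 hd
      exact Finset.mem_filter.2 ⟨snoc_mem_chains.2 ⟨he, h1, hd⟩, Fin.snoc_last _ _⟩
    · intro d hd
      obtain ⟨-, rfl⟩ := Finset.mem_filter.1 hd
      exact Fin.snoc_init_self d
    · intro d _
      exact Fin.init_snoc _ _
    · intro d hd
      obtain ⟨-, rfl⟩ := Finset.mem_filter.1 hd
      rw [Fin.prod_univ_castSucc]
      simp only [Fin.init, Fin.succ_last, Fin.castSucc_zero, Fin.succ_castSucc]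
      ring
  · intro d hd
    obtain ⟨hd, h1⟩ := Finset.mem_filter.1 hd
    exact Finset.mem_filter.2 ⟨(mem_chains.1 hd).1 _, h1⟩

/-- Induction on `n - a`: every `b` in the recursion is a larger divisor of `n`. -/
theorem eq_sum_chainSumFrom {n : ℕ} {F V : ℕ → M} {w : ℕ → ℕ → M}
    (h : ∀ a ∈ n.divisors, F a = V a + ∑ b ∈ n.divisors with a ∣ b ∧ a ≠ b, w a b * F b)
    {a : ℕ} (ha : a ∈ n.divisors) : F a = ∑ k ∈ Finset.range n, chainSumFrom n V w k a := by
  obtain ⟨m, hm⟩ : ∃ m, m = n - a := ⟨_, rfl⟩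
  induction m using Nat.strong_induction_on generalizing a with
  | _ m ih =>
    -- No chain has `n` steps, so the range may be extended by one; its `k = 0` term then splits
    -- off, and the shifted rest matches the recursion.
    have hlast : chainSumFrom n V w n a = 0 := by
      rw [chainSumFrom, chains_eq_empty le_rfl]
      simp
    rw [← add_zero (∑ k ∈ Finset.range n, _), ← hlast, ← Finset.sum_range_succ,
      Finset.sum_range_succ', chainSumFrom_zero V w ha, h a ha, add_comm]
    congr 1
    simp only [chainSumFrom_succ V w _ ha]
    rw [Finset.sum_comm]
    refine Finset.sum_congr rfl fun b hb => ?_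
    obtain ⟨hb, hab, hne⟩ := Finset.mem_filter.1 hb
    have hbn := Nat.divisor_le hb
    have hab' := Nat.le_of_dvd (Nat.pos_of_mem_divisors hb) hab
    rw [← Finset.mul_sum, ih (n - b) (by omega) hb rfl]

theorem eq_sum_chainSumTo {n : ℕ} {F V : ℕ → M} {w : ℕ → ℕ → M}
    (h : ∀ e ∈ n.divisors, F e = V e + ∑ b ∈ n.divisors with b ∣ e ∧ b ≠ e, F b * w b e)
    {e : ℕ} (he : e ∈ n.divisors) : F e = ∑ k ∈ Finset.range n, chainSumTo n V w k e := by
  induction e using Nat.strong_induction_on with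
  | _ e ih =>
    have hlast : chainSumTo n V w n e = 0 := by
      rw [chainSumTo, chains_eq_empty le_rfl]
      simp
    rw [← add_zero (∑ k ∈ Finset.range n, _), ← hlast, ← Finset.sum_range_succ,
      Finset.sum_range_succ', chainSumTo_zero V w he, h e he, add_comm]
    congr 1
    simp only [chainSumTo_succ V w _ he]
    rw [Finset.sum_comm]
    refine Finset.sum_congr rfl fun b hb => ?_
    obtain ⟨hb, hbe, hne⟩ := Finset.mem_filter.1 hb
    have := Nat.le_of_dvd (Nat.pos_of_mem_divisors he) hbe
    rw [← Finset.sum_mul, ih b (by omega) hb]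

end Chains

/-! ### The two recursions in chain form -/

/-- The recursion for `Lx` at `n / a`, evaluated at `x^a` and solved for its term `d = 1`.
Substituting `b = a d` turns it into a recursion along divisors of the fixed `n`. -/
theorem sub_R1 {n a : ℕ} (ha : a ∈ n.divisors) :
    sub (R1 (n / a)) a = sub (Lx (n / a)) a +
      ∑ b ∈ n.divisors with a ∣ b ∧ a ≠ b,
        -(sub (C (b / a)) a * LaurentPolynomial.T (-(b : ℤ))) * sub (R1 (n / b)) b := by
  obtain ⟨⟨m, rfl⟩, hn⟩ := Nat.mem_divisors.1 ha
  have ha0 : 0 < a := Nat.pos_of_mem_divisors ha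
  have hm0 : 0 < m := Nat.pos_of_ne_zero fun h => hn (by rw [h, mul_zero])
  have e : ∑ b ∈ (a * m).divisors with a ∣ b ∧ a ≠ b,
      -(sub (C (b / a)) a * LaurentPolynomial.T (-(b : ℤ))) * sub (R1 (a * m / b)) b =
      -∑ d ∈ m.divisors.erase 1, sub (C d) a *
      (sub (R1 (m / d)) (a * d) * LaurentPolynomial.T (-((a * d : ℕ) : ℤ))) := by
    rw [← Finset.sum_neg_distrib]
    refine Finset.sum_nbij' (fun b => b / a) (fun d => a * d) ?_ ?_ ?_ ?_ ?_
    · intro b hb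
      obtain ⟨hb, ⟨c, rfl⟩, hne⟩ := Finset.mem_filter.1 hb
      rw [Nat.mul_div_cancel_left _ ha0, Finset.mem_erase, Nat.mem_divisors]
      refine ⟨?_, Nat.dvd_of_mul_dvd_mul_left ha0 (Nat.dvd_of_mem_divisors hb), hm0.ne'⟩
      rintro rfl
      exact hne (mul_one a).symm
    · intro d hd
      obtain ⟨h1, hd⟩ := Finset.mem_erase.1 hd
      refine Finset.mem_filter.2 ⟨Nat.mem_divisors.2
        ⟨Nat.mul_dvd_mul_left a (Nat.dvd_of_mem_divisors hd), hn⟩, dvd_mul_right _ _, ?_⟩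
      intro h
      exact h1 (Nat.eq_of_mul_eq_mul_left ha0 (by rw [mul_one]; exact h.symm))
    · intro b hb
      obtain ⟨hb, hd, hne⟩ := Finset.mem_filter.1 hb
      exact Nat.mul_div_cancel' hd
    · intro d _
      exact Nat.mul_div_cancel_left _ ha0
    · intro b hb
      obtain ⟨hb, ⟨c, rfl⟩, hne⟩ := Finset.mem_filter.1 hb
      rw [Nat.mul_div_cancel_left _ ha0, Nat.mul_div_mul_left _ _ ha0]
      ring
  rw [e, Nat.mul_div_cancel_left _ ha0, sub_Lx hm0,
    ← Finset.add_sum_erase _ _ (Nat.one_mem_divisors.2 hm0.ne'), C_one, Nat.div_one, mul_one]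
  have h1 : sub Polynomial.X a = LaurentPolynomial.T (a : ℤ) := by
    rw [sub, Polynomial.X_comp, Polynomial.toLaurent_X_pow]
  -- The term `d = 1` has coefficient `C_1(x^a) / x^a = 1`.
  have h2 : (LaurentPolynomial.T (a : ℤ) * LaurentPolynomial.T (-(a : ℤ)) :
      LaurentPolynomial ℤ) = 1 := by
    rw [← LaurentPolynomial.T_add, add_neg_cancel, LaurentPolynomial.T_zero]
  rw [h1, mul_left_comm, h2]
  ring

theorem toLaurent_R_of_mem_divisors {n e : ℕ} (he : e ∈ n.divisors) :
    Polynomial.toLaurent (R e) = Polynomial.toLaurent (S e) +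
      ∑ b ∈ n.divisors with b ∣ e ∧ b ≠ e, Polynomial.toLaurent (R b) *
        (sub (R1 (e / b)) b * LaurentPolynomial.T (-(b : ℤ))) := by
  have he0 : 0 < e := Nat.pos_of_mem_divisors he
  obtain ⟨hen, hn⟩ := Nat.mem_divisors.1 he
  have h1 : ({b ∈ n.divisors | b ∣ e ∧ b ≠ e} : Finset ℕ) = e.divisors.erase e := by
    ext b
    rw [Finset.mem_filter, Finset.mem_erase, Nat.mem_divisors, Nat.mem_divisors]
    exact ⟨fun h => ⟨h.2.2, h.2.1, he0.ne'⟩, fun h => ⟨⟨h.2.1.trans hen, hn⟩, h.2.1, h.1⟩⟩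
  rw [toLaurent_R he0, h1, ← Finset.add_sum_erase _ _ (Nat.mem_divisors_self e he0.ne'),
    Nat.div_self he0, R1_one]
  simp [sub]

end RibbonComp

theorem mainTheorem3 (n : ℕ) (hn : 0 < n) :
    Polynomial.toLaurent (RibbonComp.R1 n) =
      ∑ k ∈ Finset.range n, ∑ d ∈ RibbonComp.chains n k with d 0 = 1,
        (-1 : LaurentPolynomial ℤ) ^ k *
          RibbonComp.sub (RibbonComp.Lx (n / d (Fin.last k))) (d (Fin.last k)) *
          ∏ i : Fin k,
            (RibbonComp.sub (RibbonComp.C (d i.succ / d i.castSucc)) (d i.castSucc) *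
              LaurentPolynomial.T (-(d i.succ : ℤ)))
    ∧
    Polynomial.toLaurent (RibbonComp.R n) =
      ∑ k ∈ Finset.range n, ∑ d ∈ RibbonComp.chains n k with d (Fin.last k) = n,
        Polynomial.toLaurent (RibbonComp.S (d 0)) *
          ∏ i : Fin k,
            (RibbonComp.sub (RibbonComp.R1 (d i.succ / d i.castSucc)) (d i.castSucc) *
              LaurentPolynomial.T (-(d i.castSucc : ℤ))) := by
  constructor
  · have h := RibbonComp.eq_sum_chainSumFrom
      (F := fun a => RibbonComp.sub (RibbonComp.R1 (n / a)) a)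
      (V := fun a => RibbonComp.sub (RibbonComp.Lx (n / a)) a)
      (w := fun a b => -(RibbonComp.sub (RibbonComp.C (b / a)) a *
        LaurentPolynomial.T (-(b : ℤ))))
      (fun a ha => RibbonComp.sub_R1 ha) (Nat.one_mem_divisors.2 hn.ne')
    simp only [Nat.div_one, RibbonComp.sub_one] at h
    rw [h]
    refine Finset.sum_congr rfl fun k _ => Finset.sum_congr rfl fun d _ => ?_
    -- Each of the `k` steps carries one minus sign, which together form `(-1)^k`.
    simp only [Finset.prod_neg, Finset.card_univ, Fintype.card_fin]
    ring
  · exact RibbonComp.eq_sum_chainSumTo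
      (F := fun e => Polynomial.toLaurent (RibbonComp.R e))
      (V := fun e => Polynomial.toLaurent (RibbonComp.S e))
      (w := fun b e => RibbonComp.sub (RibbonComp.R1 (e / b)) b *
        LaurentPolynomial.T (-(b : ℤ)))
      (fun e he => RibbonComp.toLaurent_R_of_mem_divisors he) (Nat.mem_divisors_self n hn.ne')
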